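/- Let $\mathbb{K}$ be a field. A duplicial algebra is a $\mathbb{K}$-vector space $A$ with two bilinear operations $\prec,\succ$ satisfying $$(x\prec y)\prec z=x\prec(y\prec z),\qquad (x\succ y)\prec z=x\succ(y\prec z),\qquad (x\succ y)\succ z=x\succ(y\succ z).$$ Let $Dup$ be the corresponding nonsymmetric binary quadratic operad, i.e. the quotient of the free nonsymmetric operad on the two binary operations $\prec,\succ$ by the operadic ideal generated by these three relators. Let $Dup^!$ be its Koszul dual, presented by the dual generators (again written $\prec,\succ$) and by the orthogonal of the relators for the pairing under which the monomials $(x\,e\,y)\,f\,z$ and $x\,e\,(y\,f\,z)$, $e,f\in\{\prec,\succ\}$, form orthogonal families with $\langle m,m\rangle=1$ for $m=(x\,e\,y)\,f\,z$ and $\langle m,m\rangle=-1$ for $m=x\,e\,(y\,f\,z)$. For a duplicial algebra $A$ let $C^{Dup}_n(A)=(Dup^!_n)^*\otimes A^{\otimes n}$ ($n\ge1$) be the operadic chain complex, with differential $$d(f\otimes a_0\cdots a_n)=\sum_{i=0}^{n-1}\ \sum_{e\in\{\prec,\succ\}}(-1)^i f(-\circ_i e)\otimes a_0\cdots (a_i\,e\,a_{i+1})\cdots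 a_n .$$ 1. The operad $Dup$ is a Koszul operad: its Koszul complex, with components $(Dup^!_k)^*\otimes\big(\bigoplus_n Dup_n\big)^{\otimes k}$, $k\ge 1$, is acyclic, i.e. its homology is $Dup_1=\mathbb{K}\,\mathrm{id}$ in degree $k=1$ and $0$ in degrees $k\geq 2$. 2. The space of relators of $Dup^!$ is spanned by the three duplicial relators together with $(x\prec y)\succ z$ and $x\prec(y\succ z)$. Equivalently, the $Dup^!$-algebras are the duplicial algebras satisfying $(x\prec y)\succ z=0=x\prec(y\succ z)$ for all $x,y,z$. 3. For every duplicial algebra $A$, put $C_{pq}(A)=A^{\otimes p+q+1}$ ($p,q\ge0$) and $$d^h(a_0\cdots a_{p+q})=\sum_{i=0}^{p-1}(-1)^i a_0\cdots(a_i\succ a_{i+1})\cdots a_{p+q},\qquad d^v(a_0\cdots a_{p+q})=\sum_{j=p}^{p+q-1}(-1)^j a_0\cdots(a_j\prec a_{j+1})\cdots a_{p+q}.$$ Then $d^hd^h=0$, $d^vd^v=0$, $d^hd^v+d^vd^h=0$, and the maps $C^{Dup}_{n+1}(A)\to\bigoplus_{p+q=n}C_{pq}(A)$, $n\geq 0$,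 whose $(p,q)$-component is $f\otimes a\mapsto f(x\succ\cdots\succ x\prec\cdots\prec x)\,a$ (with $p$ symbols $\succ$ and $q$ symbols $\prec$) are bijective and carry $d$ to $d^h+d^v$. Thus, up to a shift of degree by one, the operadic chain complex of $A$ is the total complex of this bicomplex, whose rows and columns are of Hochschild type. 4. If $A$ is a free duplicial algebra on a vector space $V$, with structure map $\iota:V\to A$, then $H_n(C^{Dup}_*(A))=0$ for $n\ge2$, and $\iota$ induces an isomorphism $V\cong H_1(C^{Dup}_*(A))$. More precisely, there is a linear map $\pi:A\to V$ with $\pi\circ\iota=\mathrm{id}_V$ such that the sequence $\cdots\to C^{Dup}_2(A)\to C^{Dup}_1(A)\to V\to 0$, with last map $f\otimes a\mapsto f(\mathrm{id})\,\pi(a)$, is exact. -/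

import Mathlib

universe u v w

open scoped TensorProduct

noncomputable section

namespace NSKoszul

/-! ### Nonsymmetric operads -/

/-- A nonsymmetric operad in `K`-vector spaces, presented by its partial compositions
`comp i : Op m ⊗ Op n → Op (m + n - 1)` (insertion into the `i`-th input, inputs being numbered
from `0`).  The target arity `k` is recorded by an equation `m + n = k + 1`. -/
structure NSOperad (K : Type u) [Field K] where
  /-- The space of `n`-ary operations. -/
  Op : ℕ → Type v
  [addCommGroup : ∀ n, AddCommGroup (Op n)]
  [module : ∀ n, Module K (Op n)]
  /-- The identity operation. -/
  one : Op 1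
  /-- Partial composition. -/
  comp : ∀ {m n k : ℕ} (_ : Fin m) (_ : m + n = k + 1), Op m →ₗ[K] Op n →ₗ[K] Op k
  one_comp : ∀ {n : ℕ} (h : 1 + n = n + 1) (x : Op n), comp 0 h one x = x
  comp_one : ∀ {m : ℕ} (i : Fin m) (h : m + 1 = m + 1) (x : Op m), comp i h x one = x
  /-- Sequential composition axiom. -/
  comp_assoc : ∀ {l m n a b c : ℕ} (i : Fin l) (j : Fin m) (p : Fin a)
    (_ : (p : ℕ) = i + j) (h₁ : l + m = a + 1) (h₂ : a + n = b + 1)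
    (h₃ : m + n = c + 1) (h₄ : l + c = b + 1) (x : Op l) (y : Op m) (z : Op n),
    comp p h₂ (comp i h₁ x y) z = comp i h₄ x (comp j h₃ y z)
  /-- Parallel composition axiom. -/
  comp_comm : ∀ {l m n a b c : ℕ} (i k : Fin l) (_ : i < k) (p : Fin a) (q : Fin c)
    (_ : (p : ℕ) + 1 = k + m) (_ : (q : ℕ) = i)
    (h₁ : l + m = a + 1) (h₂ : a + n = b + 1)
    (h₃ : l + n = c + 1) (h₄ : c + m = b + 1) (x : Op l) (y : Op m) (z : Op n),
    comp p h₂ (comp i h₁ x y) z = comp q h₄ (comp k h₃ x z) y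

attribute [instance] NSOperad.addCommGroup NSOperad.module

/-! ### Operadic ideals and quotients -/

section Ideal

variable {K : Type u} [Field K] (P : NSOperad.{u, v} K)

/-- Membership in the operadic ideal generated by a family `S` of operations: the smallest family
of subspaces which contains `S` and is stable under composition, on either side, with arbitrary
operations. -/
inductive IdealMem (S : ∀ n, Set (P.Op n)) : ∀ n, P.Op n → Prop
  | of {n : ℕ} (x : P.Op n) (hx : x ∈ S n) : IdealMem S n x
  | zero (n : ℕ) : IdealMem S n 0
  | add {n : ℕ} (x y : P.Op n) (hx : IdealMem S n x) (hy : IdealMem S n y) : IdealMem S n (x + y)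
  | smul {n : ℕ} (c : K) (x : P.Op n) (hx : IdealMem S n x) : IdealMem S n (c • x)
  | comp_left {m n k : ℕ} (i : Fin m) (h : m + n = k + 1) (x : P.Op m) (y : P.Op n)
      (hx : IdealMem S m x) : IdealMem S k (P.comp i h x y)
  | comp_right {m n k : ℕ} (i : Fin m) (h : m + n = k + 1) (x : P.Op m) (y : P.Op n)
      (hy : IdealMem S n y) : IdealMem S k (P.comp i h x y)

/-- The arity `n` part of the operadic ideal generated by `S`. -/
def ideal (S : ∀ n, Set (P.Op n)) (n : ℕ) : Submodule K (P.Op n) where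
  carrier := {x | IdealMem P S n x}
  zero_mem' := IdealMem.zero n
  add_mem' := fun hx hy => IdealMem.add _ _ hx hy
  smul_mem' := fun c _ hx => IdealMem.smul c _ hx

/-- The partial composition induced on the quotient by an operadic ideal. -/
def quotientComp (S : ∀ n, Set (P.Op n)) {m n k : ℕ} (i : Fin m) (h : m + n = k + 1) :
    (P.Op m ⧸ ideal P S m) →ₗ[K] (P.Op n ⧸ ideal P S n) →ₗ[K] (P.Op k ⧸ ideal P S k) :=
  ((ideal P S n).liftQ
    ((ideal P S m).liftQ ((P.comp i h).compr₂ (ideal P S k).mkQ) (by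
      intro x hx
      ext y
      exact (Submodule.Quotient.mk_eq_zero _).2 (IdealMem.comp_left i h x y hx))).flip (by
    intro y hy
    ext x
    exact (Submodule.Quotient.mk_eq_zero _).2 (IdealMem.comp_right i h x y hy))).flip

theorem quotientComp_mk (S : ∀ n, Set (P.Op n)) {m n k : ℕ} (i : Fin m) (h : m + n = k + 1)
    (x : P.Op m) (y : P.Op n) :
    quotientComp P S i h (Submodule.Quotient.mk x) (Submodule.Quotient.mk y) =
      Submodule.Quotient.mk (P.comp i h x y) := rfl

/-- The quotient of a nonsymmetric operad by the operadic ideal generated by `S`. -/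
def quotient (S : ∀ n, Set (P.Op n)) : NSOperad.{u, v} K where
  Op n := P.Op n ⧸ ideal P S n
  one := Submodule.Quotient.mk P.one
  comp i h := quotientComp P S i h
  one_comp h x := by
    induction x using Submodule.Quotient.induction_on with
    | H x => rw [quotientComp_mk, P.one_comp]
  comp_one i h x := by
    induction x using Submodule.Quotient.induction_on with
    | H x => rw [quotientComp_mk, P.comp_one]
  comp_assoc i j p hp h₁ h₂ h₃ h₄ x y z := by
    induction x using Submodule.Quotient.induction_on with
    | H x =>
    induction y using Submodule.Quotient.induction_on with
    | H y =>
    induction z using Submodule.Quotient.induction_on with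
    | H z => simp only [quotientComp_mk, P.comp_assoc i j p hp h₁ h₂ h₃ h₄]
  comp_comm i k hik p q hp hq h₁ h₂ h₃ h₄ x y z := by
    induction x using Submodule.Quotient.induction_on with
    | H x =>
    induction y using Submodule.Quotient.induction_on with
    | H y =>
    induction z using Submodule.Quotient.induction_on with
    | H z => simp only [quotientComp_mk, P.comp_comm i k hik p q hp hq h₁ h₂ h₃ h₄]

end Ideal

/-! ### The free nonsymmetric operad on a set of binary generators -/

/-- Planar binary trees whose internal vertices are labelled by `E`. -/
inductive PTree (E : Type) : Type
  | leaf : PTree E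
  | node (e : E) (l r : PTree E) : PTree E

namespace PTree

variable {E : Type}

/-- The number of leaves. -/
def leaves : PTree E → ℕ
  | leaf => 1
  | node _ l r => l.leaves + r.leaves

/-- `graft t i s` grafts the root of `s` on the `i`-th leaf of `t` (counted from the left, from
`0`; only meaningful for `i < t.leaves`). -/
def graft : PTree E → ℕ → PTree E → PTree E
  | leaf, _, s => s
  | node e l r, i, s =>
    if i < l.leaves then node e (l.graft i s) r else node e l (r.graft (i - l.leaves) s)

theorem leaves_pos (t : PTree E) : 0 < t.leaves := by
  induction t with
  | leaf => simp [leaves]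
  | node e l r hl hr => simp only [leaves]; omega

theorem leaves_graft (t s : PTree E) (i : ℕ) (hi : i < t.leaves) :
    (t.graft i s).leaves + 1 = t.leaves + s.leaves := by
  induction t generalizing i with
  | leaf => simp only [graft, leaves]; omega
  | node e l r hl hr =>
    simp only [graft, leaves] at hi ⊢
    split_ifs with h
    · have := hl i h
      simp only [leaves]; omega
    · have := hr (i - l.leaves) (by omega)
      simp only [leaves]; omega

theorem graft_leaf (t : PTree E) (i : ℕ) : t.graft i leaf = t := by
  induction t generalizing i with
  | leaf => rfl
  | node e l r hl hr => simp only [graft, hl, hr, ite_self]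

theorem graft_assoc (t s r : PTree E) (i j : ℕ) (hi : i < t.leaves) (hj : j < s.leaves) :
    (t.graft i s).graft (i + j) r = t.graft i (s.graft j r) := by
  induction t generalizing i with
  | leaf =>
    have : i = 0 := by simp only [leaves] at hi; omega
    subst this
    simp [graft]
  | node e a b ha hb =>
    simp only [leaves] at hi
    by_cases h : i < a.leaves
    · have h1 := leaves_graft a s i h
      have h2 : i + j < (a.graft i s).leaves := by omega
      simp only [graft, h, if_true, h2, ha i h]
    · have h2 : ¬ (i + j < a.leaves) := by omega
      have h3 : i + j - a.leaves = (i - a.leaves) + j := by omega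
      simp only [graft, h, if_false, h2, h3, hb (i - a.leaves) (by omega)]

theorem graft_comm (t s r : PTree E) (i k p : ℕ) (hik : i < k) (hk : k < t.leaves)
    (hp : p + 1 = k + s.leaves) :
    (t.graft i s).graft p r = (t.graft k r).graft i s := by
  induction t generalizing i k p with
  | leaf => simp only [leaves] at hk; omega
  | node e a b ha hb =>
    simp only [leaves] at hk
    have hs := leaves_pos s
    by_cases h : i < a.leaves
    · have h1 := leaves_graft a s i h
      by_cases h' : k < a.leaves
      · have h2 := leaves_graft a r k h'
        have hr := leaves_pos r
        have h3 : p < (a.graft i s).leaves := by omega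
        have h4 : i < (a.graft k r).leaves := by omega
        simp only [graft, h, h', if_true, h3, h4, ha i k p hik h' hp]
      · have h3 : ¬ (p < (a.graft i s).leaves) := by omega
        have h4 : p - (a.graft i s).leaves = k - a.leaves := by omega
        simp only [graft, h, h', if_true, if_false, h3, h4]
    · have h' : ¬ (k < a.leaves) := by omega
      have h3 : ¬ (p < a.leaves) := by omega
      simp only [graft, h, h', if_false, h3,
        hb (i - a.leaves) (k - a.leaves) (p - a.leaves) (by omega) (by omega) (by omega)]

/-- The sign of a tree with three leaves: `+1` for `(x y) z` and `-1` for `x (y z)`. -/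
def sign : PTree E → ℤ
  | node _ (node _ _ _) _ => 1
  | _ => -1

/-- The value of a tree at the inputs `a 0, a 1, ...` when each label is interpreted as a binary
operation. -/
def eval {A : Type w} (op : E → A → A → A) : PTree E → (ℕ → A) → A
  | leaf, a => a 0
  | node e l r, a => op e (l.eval op a) (r.eval op fun j => a (l.leaves + j))

end PTree

section Free

variable (K : Type u) [Field K] (E : Type)

/-- The vector space with basis the `E`-labelled planar binary trees with `n` leaves. -/
abbrev TreeModule (n : ℕ) : Type u := {t : PTree E // t.leaves = n} →₀ K

variable {E}

/-- Grafting, with control of the number of leaves. -/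
def graftArity {m n k : ℕ} (i : Fin m) (h : m + n = k + 1) (t : {t : PTree E // t.leaves = m})
    (s : {t : PTree E // t.leaves = n}) : {t : PTree E // t.leaves = k} :=
  ⟨t.1.graft i s.1, by
    have := PTree.leaves_graft t.1 s.1 i (by rw [t.2]; exact i.2)
    rw [t.2, s.2] at this
    omega⟩

/-- The bilinear extension of grafting. -/
def treeComp {m n k : ℕ} (i : Fin m) (h : m + n = k + 1) :
    TreeModule K E m →ₗ[K] TreeModule K E n →ₗ[K] TreeModule K E k :=
  Finsupp.linearCombination K fun t => Finsupp.lmapDomain K K (graftArity i h t)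

theorem treeComp_single {m n k : ℕ} (i : Fin m) (h : m + n = k + 1)
    (t : {t : PTree E // t.leaves = m}) (s : {t : PTree E // t.leaves = n}) (a b : K) :
    treeComp K i h (Finsupp.single t a) (Finsupp.single s b) =
      Finsupp.single (graftArity i h t s) (a * b) := by
  simp [treeComp]

variable (E)

/-- The free nonsymmetric operad on a set `E` of binary operations. -/
def freeOperad : NSOperad.{u, u} K where
  Op n := TreeModule K E n
  one := Finsupp.single ⟨PTree.leaf, rfl⟩ 1
  comp i h := treeComp K i h
  one_comp h x := by
    induction x using Finsupp.induction_linear with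
    | zero => simp
    | add x y hx hy => simp only [map_add, hx, hy]
    | single t a =>
      rw [treeComp_single, one_mul]
      rfl
  comp_one i h x := by
    induction x using Finsupp.induction_linear with
    | zero => simp
    | add x y hx hy => simp only [map_add, LinearMap.add_apply, hx, hy]
    | single t a =>
      rw [treeComp_single, mul_one]
      congr 1
      exact Subtype.ext (PTree.graft_leaf _ _)
  comp_assoc i j p hp h₁ h₂ h₃ h₄ x y z := by
    induction x using Finsupp.induction_linear with
    | zero => simp
    | add x x' hx hx' => simp only [map_add, LinearMap.add_apply, hx, hx']
    | single t a =>
    induction y using Finsupp.induction_linear with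
    | zero => simp
    | add y y' hy hy' => simp only [map_add, LinearMap.add_apply, hy, hy']
    | single s b =>
    induction z using Finsupp.induction_linear with
    | zero => simp
    | add z z' hz hz' => simp only [map_add, hz, hz']
    | single r c =>
      simp only [treeComp_single, mul_assoc]
      congr 1
      apply Subtype.ext
      simp only [graftArity, hp]
      exact PTree.graft_assoc _ _ _ _ _ (by rw [t.2]; exact i.2) (by rw [s.2]; exact j.2)
  comp_comm i k hik p q hp hq h₁ h₂ h₃ h₄ x y z := by
    induction x using Finsupp.induction_linear with
    | zero => simp
    | add x x' hx hx' => simp only [map_add, LinearMap.add_apply, hx, hx']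
    | single t a =>
    induction y using Finsupp.induction_linear with
    | zero => simp
    | add y y' hy hy' => simp only [map_add, LinearMap.add_apply, hy, hy']
    | single s b =>
    induction z using Finsupp.induction_linear with
    | zero => simp
    | add z z' hz hz' => simp only [map_add, LinearMap.add_apply, hz, hz']
    | single r c =>
      simp only [treeComp_single, mul_right_comm a b c]
      congr 1
      apply Subtype.ext
      simp only [graftArity, hq]
      exact PTree.graft_comm _ _ _ _ _ _ hik (by rw [t.2]; exact k.2) (by rw [s.2]; exact hp)

end Free

/-! ### Binary quadratic operads and their Koszul duals -/

section Quadratic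

variable {K : Type u} [Field K] {E : Type}

/-- The family of operations consisting of the relators `R` in arity `3`. -/
def relators (R : Submodule K (TreeModule K E 3)) : ∀ n, Set ((freeOperad K E).Op n)
  | 3 => (R : Set (TreeModule K E 3))
  | _ => ∅

/-- The binary quadratic operad with generating operations `E` and space of relators `R`: the
quotient of the free operad on `E` by the operadic ideal generated by `R`. -/
def quadraticOperad (R : Submodule K (TreeModule K E 3)) : NSOperad.{u, u} K :=
  quotient (freeOperad K E) (relators R)

/-- The class of a tree in a quadratic operad. -/
def treeClass (R : Submodule K (TreeModule K E 3)) {n : ℕ} (t : PTree E) (h : t.leaves = n) :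
    (quadraticOperad R).Op n :=
  (ideal (freeOperad K E) (relators R) n).mkQ
    (Finsupp.single (⟨t, h⟩ : {t : PTree E // t.leaves = n}) (1 : K) : TreeModule K E n)

/-- The generating operation labelled by `e`. -/
def generator (R : Submodule K (TreeModule K E 3)) (e : E) : (quadraticOperad R).Op 2 :=
  treeClass R (PTree.node e PTree.leaf PTree.leaf) rfl

/-- The orthogonal `R^⊥` of the space of relators, for the pairing between the arity `3` parts of
the free operads on the generators and on the dual generators: the trees form orthogonal bases,
`⟨(x y) z, (x y) z⟩ = 1` and `⟨x (y z), x (y z)⟩ = -1` when the labels agree.  The basis dual to the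
generators is indexed by `E` again. -/
def orthogonal (R : Submodule K (TreeModule K E 3)) : Submodule K (TreeModule K E 3) :=
  ⨅ r ∈ R, LinearMap.ker
    (Finsupp.linearCombination K fun t : {t : PTree E // t.leaves = 3} => (t.1.sign : K) * r t)

/-- The Koszul dual operad `P^!` of the quadratic operad `P` given by `R`. -/
def koszulDual (R : Submodule K (TreeModule K E 3)) : NSOperad.{u, u} K :=
  quadraticOperad (orthogonal R)

/-- `(A, op)` is an algebra of the type defined by the generating operations `E` and the
relators `R`: every relator vanishes identically on `A`. -/
def IsAlgebraOfType (R : Submodule K (TreeModule K E 3)) {A : Type w} [AddCommGroup A]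
    [Module K A] (op : E → A →ₗ[K] A →ₗ[K] A) : Prop :=
  ∀ r ∈ R, ∀ a : ℕ → A,
    (Finsupp.linearCombination K fun t : {t : PTree E // t.leaves = 3} =>
      t.1.eval (fun e x y => op e x y) a) r = 0

end Quadratic

/-! ### The operadic chain complex of an algebra -/

section Tensor

variable {K : Type u} [Field K] {A : Type w} [AddCommGroup A] [Module K A]

/-- Contracting a family in which one entry is replaced by `x` replaces one entry of the contracted
family by a linear function of `x`. -/
theorem contract_update (μ : A →ₗ[K] A →ₗ[K] A) {m k : ℕ} (h : m = k + 1)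
    (i : Fin k) (inst : DecidableEq (Fin m)) (a : Fin m → A) (j : Fin m) :
    ∃ (t : Fin k) (φ : A →ₗ[K] A), ∀ x : A,
      (Fin.contractNth i.castSucc (fun x y => μ x y) fun l =>
        (@Function.update _ _ inst a j x) (Fin.cast h.symm l)) =
      Function.update (Fin.contractNth i.castSucc (fun x y => μ x y) fun l =>
        a (Fin.cast h.symm l)) t (φ x) := by
  subst h
  obtain rfl : inst = instDecidableEqFin _ := Subsingleton.elim _ _
  have hi := i.2
  have hj := j.2
  rcases lt_trichotomy (j : ℕ) i with hji | hji | hji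
  · refine ⟨⟨j, by omega⟩, LinearMap.id, fun x => funext fun l => ?_⟩
    simp only [Fin.contractNth, Function.update_apply, Fin.ext_iff, Fin.val_cast, Fin.val_castSucc,
      Fin.val_succ, LinearMap.id_apply]
    grind
  · refine ⟨i, μ.flip (a i.succ), fun x => funext fun l => ?_⟩
    simp only [Fin.contractNth, Function.update_apply, Fin.ext_iff, Fin.val_cast, Fin.val_castSucc,
      Fin.val_succ, LinearMap.flip_apply]
    have : l = i ∨ (l : ℕ) ≠ i := by rw [Fin.ext_iff]; tauto
    rcases this with rfl | hl
    · simp [hji]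
    · grind
  · by_cases hj' : (j : ℕ) = i + 1
    · refine ⟨i, μ (a i.castSucc), fun x => funext fun l => ?_⟩
      simp only [Fin.contractNth, Function.update_apply, Fin.ext_iff, Fin.val_cast,
        Fin.val_castSucc, Fin.val_succ]
      have : l = i ∨ (l : ℕ) ≠ i := by rw [Fin.ext_iff]; tauto
      rcases this with rfl | hl
      · simp [hj']
      · grind
    · refine ⟨⟨j - 1, by omega⟩, LinearMap.id, fun x => funext fun l => ?_⟩
      simp only [Fin.contractNth, Function.update_apply, Fin.ext_iff, Fin.val_cast,
        Fin.val_castSucc, Fin.val_succ, LinearMap.id_apply]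
      grind

/-- The multilinear map `(a_0, ..., a_k) ↦ a_0 ⊗ ⋯ ⊗ μ(a_i, a_{i+1}) ⊗ ⋯ ⊗ a_k`, where the number
of inputs is `m = k + 1`. -/
def faceMultilinear (μ : A →ₗ[K] A →ₗ[K] A) {m k : ℕ} (h : m = k + 1) (i : Fin k) :
    MultilinearMap K (fun _ : Fin m => A) (⨂[K] _ : Fin k, A) where
  toFun a := PiTensorProduct.tprod K
    (Fin.contractNth i.castSucc (fun x y => μ x y) fun j => a (Fin.cast h.symm j))
  map_update_add' := by
    intro inst a j x y
    obtain ⟨t, φ, hφ⟩ := contract_update μ h i inst a j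
    rw [hφ, hφ, hφ, map_add, MultilinearMap.map_update_add]
  map_update_smul' := by
    intro inst a j c x
    obtain ⟨t, φ, hφ⟩ := contract_update μ h i inst a j
    rw [hφ, hφ, map_smul, MultilinearMap.map_update_smul]

/-- The map `a_0 ⊗ ⋯ ⊗ a_k ↦ a_0 ⊗ ⋯ ⊗ μ(a_i, a_{i+1}) ⊗ ⋯ ⊗ a_k` on tensor powers. -/
def face (μ : A →ₗ[K] A →ₗ[K] A) {m k : ℕ} (h : m = k + 1) (i : Fin k) :
    (⨂[K] _ : Fin m, A) →ₗ[K] (⨂[K] _ : Fin k, A) :=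
  PiTensorProduct.lift (faceMultilinear μ h i)

end Tensor

section Complex

variable {K : Type u} [Field K] {E : Type} (R : Submodule K (TreeModule K E 3))

/-- The space `C_n(A) = (P^!_n)^* ⊗ A^{⊗ n}` of operadic chains. -/
abbrev Chains (A : Type w) [AddCommGroup A] [Module K A] (n : ℕ) : Type (max u w) :=
  Module.Dual K ((koszulDual R).Op n) ⊗[K] (⨂[K] _ : Fin n, A)

/-- The operation `y ↦ y ∘_i e^∨` from `P^!_n` to `P^!_{n+1}`. -/
def insertGenerator (e : E) {n : ℕ} (i : Fin n) :
    (koszulDual R).Op n →ₗ[K] (koszulDual R).Op (n + 1) :=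
  ((koszulDual R).comp i (rfl : n + 2 = (n + 1) + 1)).flip (generator (orthogonal R) e)

/-- The map `C_1(A) = (P^!_1)^* ⊗ A → V`, `f ⊗ a ↦ f(id) π(a)` induced by `π : A → V`. -/
def augmentation {A : Type w} [AddCommGroup A] [Module K A]
    {V : Type v} [AddCommGroup V] [Module K V] (π : A →ₗ[K] V) :
    Chains R A 1 →ₗ[K] V :=
  (TensorProduct.lid K V).toLinearMap ∘ₗ
    TensorProduct.map (Module.Dual.eval K _ (koszulDual R).one)
      (π ∘ₗ (PiTensorProduct.subsingletonEquiv (0 : Fin 1)).toLinearMap)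

variable [Fintype E] {A : Type w} [AddCommGroup A] [Module K A]

/-- The operadic differential `C_{n+1}(A) → C_n(A)`,
`d (f ⊗ a_0 ⋯ a_n) = ∑_i ∑_e (-1)^i f(- ∘_i e^∨) ⊗ a_0 ⋯ e(a_i, a_{i+1}) ⋯ a_n`.
The maps `f ↦ f(- ∘_i e^∨)` are the components of the infinitesimal decomposition of the cooperad
dual to `P^!` along the cogenerators, so that this is the coderivation extending the products
of `A`. -/
def differential (op : E → A →ₗ[K] A →ₗ[K] A) (n : ℕ) : Chains R A (n + 1) →ₗ[K] Chains R A n :=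
  ∑ i : Fin n, ∑ e : E, (-1 : K) ^ (i : ℕ) •
    TensorProduct.map (insertGenerator R e i).dualMap (face (op e) rfl i)

/-- The operadic homology of `(A, op)` vanishes in degrees `≥ 2`, and it is identified with `V` in
degree `1` by means of `π : A → V`: the augmented complex
`⋯ → C_3(A) → C_2(A) → C_1(A) → V → 0` is exact. -/
structure IsAcyclic (op : E → A →ₗ[K] A →ₗ[K] A) {V : Type v} [AddCommGroup V] [Module K V]
    (π : A →ₗ[K] V) : Prop where
  exact_of_pos : ∀ n : ℕ, 1 ≤ n → Function.Exact (differential R op (n + 1)) (differential R op n)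
  exact_one : Function.Exact (differential R op 1) (augmentation R π)
  surjective : Function.Surjective (augmentation R π)

end Complex

/-! ### The Koszul complex and Koszul operads -/

section Koszul

variable {K : Type u} [Field K] {E : Type} (R : Submodule K (TreeModule K E 3))

/-- The sum of all the spaces of operations of a quadratic operad `P`, that is, the free
`P`-algebra on one generator. -/
abbrev TotalSpace : Type u := DirectSum ℕ fun n => (quadraticOperad R).Op n

/-- The product `(x, y) ↦ e ∘ (x, y)`, from `P_m ⊗ P_n` to `P_{m+n}`. -/
def gradedProduct (e : E) (m n : ℕ) :
    (quadraticOperad R).Op m →ₗ[K] (quadraticOperad R).Op n →ₗ[K] (quadraticOperad R).Op (m + n) :=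
  (((quadraticOperad R).comp (0 : Fin (n + 1)) (by omega : (n + 1) + m = (m + n) + 1)) ∘ₗ
    ((quadraticOperad R).comp (1 : Fin 2) (by omega : 2 + n = (n + 1) + 1)
      (generator R e))).flip

/-- The product `(x, y) ↦ e ∘ (x, y)` on the sum of all the spaces of operations. -/
def totalProduct (e : E) : TotalSpace R →ₗ[K] TotalSpace R →ₗ[K] TotalSpace R :=
  DirectSum.toModule K ℕ _ fun m =>
    (DirectSum.toModule K ℕ _ fun n =>
      ((gradedProduct R e m n).compr₂ (DirectSum.lof K ℕ _ (m + n))).flip).flip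

/-- The binary quadratic operad `P` is a Koszul operad: its Koszul complex `P^¡ ∘ P`, whose
component of weight `k` (summed over all arities) is `(P^!_k)^* ⊗ (⨁_n P_n)^{⊗ k}`, is acyclic, that
is, the augmentation onto `P_1 = K id` is a quasi-isomorphism. -/
def IsKoszul [Fintype E] : Prop :=
  IsAcyclic R (totalProduct R) (DirectSum.component K ℕ (fun n => (quadraticOperad R).Op n) 1)

end Koszul

/-! ### Duplicial algebras -/

/-- A duplicial algebra structure on a vector space: two bilinear operations `x ≺ y` (`left`) and
`x ≻ y` (`right`) satisfying three relations. -/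
structure DuplicialAlgebra (K : Type u) [Field K] (A : Type w) [AddCommGroup A] [Module K A] where
  left : A →ₗ[K] A →ₗ[K] A
  right : A →ₗ[K] A →ₗ[K] A
  left_left : ∀ x y z, left (left x y) z = left x (left y z)
  right_left : ∀ x y z, left (right x y) z = right x (left y z)
  right_right : ∀ x y z, right (right x y) z = right x (right y z)

/-- The two generating operations of the operad of duplicial algebras. -/
inductive DupGen : Type
  | left : DupGen
  | right : DupGen
  deriving DecidableEq

instance : Fintype DupGen where
  elems := {DupGen.left, DupGen.right}
  complete := fun e => by cases e <;> simp

/-- The two operations of a duplicial algebra, indexed by the generators. -/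
def DuplicialAlgebra.op {K : Type u} [Field K] {A : Type w} [AddCommGroup A] [Module K A]
    (D : DuplicialAlgebra K A) : DupGen → A →ₗ[K] A →ₗ[K] A
  | DupGen.left => D.left
  | DupGen.right => D.right

section Dup

variable (K : Type u) [Field K]

/-- The operation `(x, y, z) ↦ (x f y) e z` of the free operad. -/
def leftComb {E : Type} (e f : E) : TreeModule K E 3 :=
  Finsupp.single ⟨PTree.node e (PTree.node f PTree.leaf PTree.leaf) PTree.leaf, rfl⟩ 1

/-- The operation `(x, y, z) ↦ x e (y f z)` of the free operad. -/
def rightComb {E : Type} (e f : E) : TreeModule K E 3 :=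
  Finsupp.single ⟨PTree.node e PTree.leaf (PTree.node f PTree.leaf PTree.leaf), rfl⟩ 1

/-- The relators of the operad `Dup`:
`(x ≺ y) ≺ z - x ≺ (y ≺ z)`, `(x ≻ y) ≺ z - x ≻ (y ≺ z)` and `(x ≻ y) ≻ z - x ≻ (y ≻ z)`. -/
def dupRelators : Submodule K (TreeModule K DupGen 3) :=
  Submodule.span K
    {leftComb K DupGen.left DupGen.left - rightComb K DupGen.left DupGen.left,
     leftComb K DupGen.left DupGen.right - rightComb K DupGen.right DupGen.left,
     leftComb K DupGen.right DupGen.right - rightComb K DupGen.right DupGen.right}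

/-- The additional relators `(x ≺ y) ≻ z` and `x ≺ (y ≻ z)`. -/
def dupExtraRelators : Submodule K (TreeModule K DupGen 3) :=
  Submodule.span K
    {leftComb K DupGen.right DupGen.left, rightComb K DupGen.left DupGen.right}

end Dup

/-- A linear map is a morphism of duplicial algebras. -/
def IsDuplicialHom {K : Type u} [Field K] {A : Type v} {B : Type w} [AddCommGroup A] [Module K A]
    [AddCommGroup B] [Module K B] (D : DuplicialAlgebra K A) (D' : DuplicialAlgebra K B)
    (g : A →ₗ[K] B) : Prop :=
  (∀ x y, g (D.left x y) = D'.left (g x) (g y)) ∧ ∀ x y, g (D.right x y) = D'.right (g x) (g y)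

/-- The duplicial algebra `A` is free over the vector space `V`, by means of `ι : V → A`. -/
def IsFreeDuplicial {K : Type u} [Field K] {V : Type v} [AddCommGroup V] [Module K V]
    {A : Type (max u v)} [AddCommGroup A] [Module K A] (D : DuplicialAlgebra K A)
    (ι : V →ₗ[K] A) : Prop :=
  ∀ (B : Type (max u v)) [AddCommGroup B] [Module K B] (D' : DuplicialAlgebra K B)
    (f : V →ₗ[K] B), ∃! g : A →ₗ[K] B, IsDuplicialHom D D' g ∧ g ∘ₗ ι = f

/-! ### The bicomplex of a duplicial algebra -/

section Bicomplex

variable {K : Type u} [Field K] {A : Type w} [AddCommGroup A] [Module K A]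

variable (K A) in
/-- The term `C_{pq}(A) = A^{⊗ p+q+1}` of the bicomplex. -/
abbrev Bi (p q : ℕ) : Type (max u w) := ⨂[K] _ : Fin (p + q + 1), A

/-- The horizontal differential `C_{p+1,q}(A) → C_{p,q}(A)`,
`a_0 ⋯ a_{p+q+1} ↦ ∑_{0 ≤ i ≤ p} (-1)^i a_0 ⋯ (a_i ≻ a_{i+1}) ⋯ a_{p+q+1}`. -/
def dHor (D : DuplicialAlgebra K A) (p q : ℕ) : Bi K A (p + 1) q →ₗ[K] Bi K A p q :=
  ∑ i : Fin (p + 1), (-1 : K) ^ (i : ℕ) •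
    face D.right (by omega : p + 1 + q + 1 = p + q + 1 + 1) ⟨i, by omega⟩

/-- The vertical differential `C_{p,q+1}(A) → C_{p,q}(A)`,
`a_0 ⋯ a_{p+q+1} ↦ ∑_{p ≤ j ≤ p+q} (-1)^j a_0 ⋯ (a_j ≺ a_{j+1}) ⋯ a_{p+q+1}`. -/
def dVer (D : DuplicialAlgebra K A) (p q : ℕ) : Bi K A p (q + 1) →ₗ[K] Bi K A p q :=
  ∑ j : Fin (q + 1), (-1 : K) ^ (p + j : ℕ) •
    face D.left (by omega : p + (q + 1) + 1 = p + q + 1 + 1) ⟨p + j, by omega⟩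

variable (K A) in
/-- The term `⨁_{p+q=n} C_{pq}(A)` of the total complex. -/
abbrev Tot (n : ℕ) : Type (max u w) := ∀ s : {s : ℕ × ℕ // s.1 + s.2 = n}, Bi K A s.1.1 s.1.2

/-- The differential `d^h + d^v` of the total complex. -/
def dTot (D : DuplicialAlgebra K A) (n : ℕ) : Tot K A (n + 1) →ₗ[K] Tot K A n :=
  LinearMap.pi fun s =>
    dHor D s.1.1 s.1.2 ∘ₗ LinearMap.proj (R := K)
      (φ := fun s : {s : ℕ × ℕ // s.1 + s.2 = n + 1} => Bi K A s.1.1 s.1.2)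
      ⟨(s.1.1 + 1, s.1.2), by have := s.2; simp only; omega⟩ +
    dVer D s.1.1 s.1.2 ∘ₗ LinearMap.proj (R := K)
      (φ := fun s : {s : ℕ × ℕ // s.1 + s.2 = n + 1} => Bi K A s.1.1 s.1.2)
      ⟨(s.1.1, s.1.2 + 1), by have := s.2; simp only; omega⟩

/-- The monomial `x ≻ (x ≻ ⋯ (x ≻ ((x ≺ x) ≺ ⋯ ≺ x)))`, with `p` operations `≻` and `q`
operations `≺`. -/
def dupMonomial : ℕ → ℕ → PTree DupGen
  | 0, 0 => PTree.leaf
  | 0, q + 1 => PTree.node DupGen.left (dupMonomial 0 q) PTree.leaf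
  | p + 1, q => PTree.node DupGen.right PTree.leaf (dupMonomial p q)

theorem leaves_dupMonomial (p q : ℕ) : (dupMonomial p q).leaves = p + q + 1 := by
  induction p with
  | zero =>
    induction q with
    | zero => simp [dupMonomial, PTree.leaves]
    | succ q ih => simp only [dupMonomial, PTree.leaves, ih]; omega
  | succ p ih => simp only [dupMonomial, PTree.leaves, ih]; omega

/-- The map from the operadic chains of `A` of degree `n + 1` to the total complex of degree `n`
whose component of bidegree `(p, q)` is
`f ⊗ a ↦ f(x ≻ ⋯ ≻ x ≺ ⋯ ≺ x) a`, with `p` operations `≻` and `q` operations `≺`. -/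
def toTot (n : ℕ) : Chains (dupRelators K) A (n + 1) →ₗ[K] Tot K A n :=
  LinearMap.pi fun s =>
    (TensorProduct.lid K (Bi K A s.1.1 s.1.2)).toLinearMap ∘ₗ
      TensorProduct.map
        (Module.Dual.eval K _ (treeClass (orthogonal (dupRelators K)) (dupMonomial s.1.1 s.1.2)
          ((leaves_dupMonomial _ _).trans (by rw [s.2]))))
        (PiTensorProduct.reindex K (fun _ : Fin (n + 1) => A)
          (finCongr (by rw [s.2]))).toLinearMap

end Bicomplex

end NSKoszul

end

noncomputable section

namespace NSKoszul

/-! ### Evaluation of trees in algebras -/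

/-! The orthogonal of the relators is a computation in the eight tree coordinates of arity three.
The three binomial relators impose three equations, each relator satisfies them because the two
signs of the pairing cancel, and the two monomials that occur in no relator come for free
(`orthogonal_dupRelators`).

In the Koszul dual, every tree is therefore zero or one of the monomials `x ≻ ⋯ ≻ x ≺ ⋯ ≺ x`
(`dualClass_eq_zero_or_dualMon`). These monomials are independent because an explicit algebra on
`K[s, t]` sends them to `s ^ p t ^ q` (`eval_dupMonomial`). Thus `monBasis` splits the chains into
copies of tensor powers indexed by `(p, q)`. Inserting `≻` into a monomial survives only at the
inputs `i ≤ p`, and inserting `≺` only at the inputs `i ≥ p`. Dually, the operadic differential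
becomes `d^h + d^v` (`evalMon_differential`). The bicomplex relations are the three duplicial
axioms.

For acyclicity, write `μ` and `ν` for the linearized products `≻` and `≺`. A free algebra `A`
carries a map `σ : A → A ⊗ A` with `μ σ = id` on the products `x ≻ y`, compatible with `≺`. Inserted
at the factor `p`, it contracts the rows in positive horizontal degree. In column zero, `ρ = id - μ
σ` kills the products by `≻`, and a second map `θ` splits `≺` in the same way after `ρ`. What
remains, `ρ - ν θ`, is `ι π`, the projection to the generators. Both maps exist because their
defining rules say that `x ↦ (x, σ x)` and `x ↦ (x, θ x)` are morphisms to suitable duplicial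
algebras on `A × (A ⊗ A)` (`IsFreeDuplicial.nonempty_contraction`). Together they give a contracting
homotopy of the augmented total complex (`Contraction.totDiff_homotopy`).

Koszulness is the special case of the free algebra on one generator, realized as the sum of all the
spaces `Dup_n` (`isFreeDuplicial_totalDuplicial`). -/

theorem PTree.eval_congr {E : Type} {A : Type w} (op : E → A → A → A) (t : PTree E)
    {a b : ℕ → A} (h : ∀ j < t.leaves, a j = b j) : t.eval op a = t.eval op b := by
  induction t generalizing a b with
  | leaf => exact h 0 (by simp [leaves])
  | node e l r hl hr =>
    simp only [leaves] at h
    simp only [eval]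
    rw [hl fun j hj => h j (by omega), hr fun j hj => h (l.leaves + j) (by omega)]

/-- Grafting is substitution: the input `i` of `t` receives the value of `s`, and the later inputs
are shifted by `s.leaves - 1`. The truncated subtraction is harmless since a tree has at least one
leaf. -/
theorem PTree.eval_graft {E : Type} {A : Type w} (op : E → A → A → A) (t s : PTree E) (i : ℕ)
    (hi : i < t.leaves) (a : ℕ → A) :
    (t.graft i s).eval op a = t.eval op fun j =>
      if j < i then a j else if j = i then s.eval op fun l => a (i + l)
      else a (j + s.leaves - 1) := by
  induction t generalizing i a with
  | leaf =>
    obtain rfl : i = 0 := by simp only [leaves] at hi; omega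
    simp [graft, eval]
  | node e l r hl hr =>
    simp only [leaves] at hi
    have hs := leaves_pos s
    by_cases h : i < l.leaves
    · have hg := leaves_graft l s i h
      simp only [graft, h, if_true, eval]
      rw [hl i h]
      congr 2
      funext j
      rw [if_neg (by omega), if_neg (by omega)]
      congr 1
      omega
    · simp only [graft, h, if_false, eval]
      rw [hr _ (by omega)]
      congr 1
      · refine eval_congr op l fun j hj => ?_
        rw [if_pos (by omega)]
      · congr 1
        funext j
        have h1 : j < i - l.leaves ↔ l.leaves + j < i := by omega
        have h2 : j = i - l.leaves ↔ l.leaves + j = i := by omega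
        simp only [h1, h2]
        split_ifs with h3 h4
        · rfl
        · congr 1
          funext k
          congr 1
          omega
        · congr 1
          omega

section Evaluation

variable {K : Type u} [Field K] {E : Type} {A : Type w} [AddCommGroup A] [Module K A]
  (op : E → A →ₗ[K] A →ₗ[K] A)

/-- The value at `a` of the elements of the free operad. -/
def evalTree (a : ℕ → A) (n : ℕ) : TreeModule K E n →ₗ[K] A :=
  Finsupp.linearCombination K fun t => t.1.eval (fun e x y => op e x y) a

theorem evalTree_single (a : ℕ → A) (n : ℕ) (t : {t : PTree E // t.leaves = n}) (c : K) :
    evalTree op a n (Finsupp.single t c) = c • t.1.eval (fun e x y => op e x y) a := by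
  simp [evalTree]

theorem evalTree_comp_single {m n k : ℕ} (i : Fin m) (h : m + n = k + 1) (x : TreeModule K E m)
    (s : {t : PTree E // t.leaves = n}) (c : K) (a : ℕ → A) :
    evalTree op a k (treeComp K i h x (Finsupp.single s c)) =
      c • evalTree op (fun j => if j < i then a j else if j = i then
        s.1.eval (fun e x y => op e x y) fun l => a (i + l) else a (j + s.1.leaves - 1)) m x := by
  induction x using Finsupp.induction_linear with
  | zero => simp
  | add x y hx hy => simp only [map_add, LinearMap.add_apply, hx, hy, smul_add]
  | single t b =>
    rw [treeComp_single, evalTree_single, evalTree_single]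
    simp only [graftArity]
    rw [PTree.eval_graft _ _ _ _ (by rw [t.2]; exact i.2), mul_comm, mul_smul]

/-- The value of `t` with `s` grafted is linear in the value of `s`: each vertex on the path from
the leaf `i` to the root applies a bilinear operation with its other argument fixed. -/
theorem evalTree_graft_eq_zero {n : ℕ} {y : TreeModule K E n}
    (hy : ∀ a : ℕ → A, evalTree op a n y = 0) (t : PTree E) (i : ℕ) (hi : i < t.leaves)
    (a : ℕ → A) :
    Finsupp.linearCombination K (fun s : {s : PTree E // s.leaves = n} =>
      (t.graft i s.1).eval (fun e x y => op e x y) a) y = 0 := by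
  induction t generalizing i a with
  | leaf => exact hy a
  | node e l r hl hr =>
    simp only [PTree.leaves] at hi
    by_cases h : i < l.leaves
    -- The inputs of `r` start at a position which depends on `n` only, so the right argument is
    -- common to all the terms of the linear combination.
    · have key : ∀ s : {s : PTree E // s.leaves = n}, (l.graft i s.1).leaves = l.leaves + n - 1 :=
        fun s => by have := PTree.leaves_graft l s.1 i h; rw [s.2] at this; omega
      have := congrArg ((op e).flip (r.eval (fun e x y => op e x y)
        fun j => a (l.leaves + n - 1 + j))) (hl i h a)
      rw [map_zero, Finsupp.apply_linearCombination] at this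
      refine Eq.trans ?_ this
      simp only [PTree.graft, h, if_true, PTree.eval, key]
      rfl
    · have := congrArg (op e (l.eval (fun e x y => op e x y) a))
        (hr (i - l.leaves) (by omega) fun j => a (l.leaves + j))
      rw [map_zero, Finsupp.apply_linearCombination] at this
      refine Eq.trans ?_ this
      simp only [PTree.graft, h, if_false, PTree.eval]
      rfl

theorem evalTree_comp_eq_zero_of_left {m n k : ℕ} (i : Fin m) (h : m + n = k + 1)
    {x : TreeModule K E m} (hx : ∀ a : ℕ → A, evalTree op a m x = 0) (y : TreeModule K E n)
    (a : ℕ → A) : evalTree op a k (treeComp K i h x y) = 0 := by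
  induction y using Finsupp.induction_linear with
  | zero => simp
  | add y z hy hz => rw [map_add, map_add, hy, hz, add_zero]
  | single s c => rw [evalTree_comp_single, hx, smul_zero]

theorem evalTree_comp_eq_zero_of_right {m n k : ℕ} (i : Fin m) (h : m + n = k + 1)
    (x : TreeModule K E m) {y : TreeModule K E n} (hy : ∀ a : ℕ → A, evalTree op a n y = 0)
    (a : ℕ → A) : evalTree op a k (treeComp K i h x y) = 0 := by
  induction x using Finsupp.induction_linear with
  | zero => simp
  | add x z hx hz => rw [map_add, LinearMap.add_apply, map_add, hx, hz, add_zero]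
  | single t c =>
    have := evalTree_graft_eq_zero op hy t.1 i (by rw [t.2]; exact i.2) a
    rw [treeComp, Finsupp.linearCombination_single, LinearMap.smul_apply, map_smul,
      Finsupp.lmapDomain_apply, evalTree, Finsupp.linearCombination_mapDomain]
    exact (congrArg (c • ·) this).trans (smul_zero c)

theorem relators_of_ne (R : Submodule K (TreeModule K E 3)) {n : ℕ} (hn : n ≠ 3) :
    relators R n = ∅ :=
  match n, hn with
  | 0, _ => rfl
  | 1, _ => rfl
  | 2, _ => rfl
  | _ + 4, _ => rfl

variable {op}

/-- The operadic ideal generated by the relators vanishes on algebras. -/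
theorem evalTree_eq_zero_of_mem_ideal {R : Submodule K (TreeModule K E 3)}
    (hA : IsAlgebraOfType R op) {n : ℕ} {x : (freeOperad K E).Op n}
    (hx : IdealMem (freeOperad K E) (relators R) n x) (a : ℕ → A) : evalTree op a n x = 0 := by
  induction hx generalizing a with
  | @of n x hx =>
    by_cases hn : n = 3
    · subst hn
      exact hA x hx a
    · rw [relators_of_ne R hn] at hx
      exact hx.elim
  | zero n => exact map_zero _
  | add x y _ _ hx hy =>
    exact (map_add _ _ _).trans (by rw [hx, hy, add_zero])
  | smul c x _ hx => exact (map_smul _ _ _).trans (by rw [hx, smul_zero])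
  | comp_left i h x y _ hx => exact evalTree_comp_eq_zero_of_left op i h hx y a
  | comp_right i h x y _ hy => exact evalTree_comp_eq_zero_of_right op i h x hy a

/-- The value at `a` of the operations of a quadratic operad. -/
def evalOp {R : Submodule K (TreeModule K E 3)} (hA : IsAlgebraOfType R op) (a : ℕ → A) (n : ℕ) :
    (quadraticOperad R).Op n →ₗ[K] A :=
  (ideal (freeOperad K E) (relators R) n).liftQ (evalTree op a n)
    fun _ hx => evalTree_eq_zero_of_mem_ideal hA hx a

theorem evalOp_treeClass {R : Submodule K (TreeModule K E 3)} (hA : IsAlgebraOfType R op)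
    (a : ℕ → A) {n : ℕ} (t : PTree E) (h : t.leaves = n) :
    evalOp hA a n (treeClass R t h) = t.eval (fun e x y => op e x y) a := by
  exact (Submodule.liftQ_apply _ _ _).trans ((evalTree_single op a n _ 1).trans (one_smul K _))

end Evaluation

/-! ### The sum of all the spaces of operations -/

section TotalSpace

variable {K : Type u} [Field K] {E : Type} (R : Submodule K (TreeModule K E 3))

theorem comp_treeClass {m n k : ℕ} (i : Fin m) (h : m + n = k + 1) {t s : PTree E}
    (ht : t.leaves = m) (hs : s.leaves = n) (hk : (t.graft i s).leaves = k) :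
    (quadraticOperad R).comp i h (treeClass R t ht) (treeClass R s hs) =
      treeClass R (t.graft i s) hk := by
  refine (quotientComp_mk _ _ _ _ _ _).trans ?_
  change Submodule.Quotient.mk (treeComp K i h _ _) = _
  rw [treeComp_single, one_mul]
  rfl

variable {R} in
theorem op_hom_ext {n : ℕ} {N : Type w} [AddCommGroup N] [Module K N]
    {f g : (quadraticOperad R).Op n →ₗ[K] N}
    (h : ∀ (t : PTree E) (ht : t.leaves = n), f (treeClass R t ht) = g (treeClass R t ht)) :
    f = g := by
  refine Submodule.linearMap_qext (ideal (freeOperad K E) (relators R) n) ?_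
  refine Finsupp.lhom_ext' fun t => LinearMap.ext_ring ?_
  exact h t.1 t.2

/-- The class of a tree in the sum of all the spaces of operations. -/
def totalClass (t : PTree E) : TotalSpace R :=
  DirectSum.lof K ℕ (fun n => (quadraticOperad R).Op n) t.leaves (treeClass R t rfl)

theorem lof_treeClass {n : ℕ} (t : PTree E) (h : t.leaves = n) :
    DirectSum.lof K ℕ (fun n => (quadraticOperad R).Op n) n (treeClass R t h) =
      totalClass R t := by
  subst h
  rfl

variable {R} in
theorem totalSpace_hom_ext {N : Type w} [AddCommGroup N] [Module K N]
    {f g : TotalSpace R →ₗ[K] N} (h : ∀ t, f (totalClass R t) = g (totalClass R t)) : f = g := by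
  refine DirectSum.linearMap_ext K fun n => op_hom_ext fun t ht => ?_
  simp only [LinearMap.comp_apply, lof_treeClass, h]

theorem totalProduct_totalClass (e : E) (t s : PTree E) :
    totalProduct R e (totalClass R t) (totalClass R s) = totalClass R (PTree.node e t s) := by
  have h1 : (PTree.node e PTree.leaf s).leaves = s.leaves + 1 := by
    simp only [PTree.leaves]; omega
  have h2 : gradedProduct R e t.leaves s.leaves (treeClass R t rfl) (treeClass R s rfl) =
      treeClass R (PTree.node e t s) rfl := by
    change (quadraticOperad R).comp (0 : Fin (s.leaves + 1)) _ ((quadraticOperad R).comp (1 : Fin 2)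
      _ (treeClass R (PTree.node e PTree.leaf PTree.leaf) rfl) (treeClass R s rfl))
      (treeClass R t rfl) = _
    rw [comp_treeClass R (t := PTree.node e PTree.leaf PTree.leaf) (1 : Fin 2) _ rfl rfl h1]
    exact comp_treeClass R (t := PTree.node e PTree.leaf s) (0 : Fin (s.leaves + 1)) _ h1 rfl rfl
  unfold totalClass totalProduct
  rw [DirectSum.toModule_lof, LinearMap.flip_apply, DirectSum.toModule_lof, LinearMap.flip_apply,
    LinearMap.compr₂_apply, h2]
  rfl

theorem mem_relators {r : TreeModule K E 3} (hr : r ∈ R) : r ∈ relators R 3 := hr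

/-- Relations between compositions of two generators hold for the products of the total space. -/
theorem totalProduct_relation {c d : K} {e f e' f' : E}
    (hr : c • leftComb K e f + d • rightComb K e' f' ∈ R) (x y z : TotalSpace R) :
    c • totalProduct R e (totalProduct R f x y) z +
      d • totalProduct R e' x (totalProduct R f' y z) = 0 := by
  let L : TotalSpace R →ₗ[K] TotalSpace R →ₗ[K] TotalSpace R →ₗ[K] TotalSpace R :=
    (totalProduct R f).compr₂ (totalProduct R e)
  let M : TotalSpace R →ₗ[K] TotalSpace R →ₗ[K] TotalSpace R →ₗ[K] TotalSpace R :=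
    (LinearMap.lcomp K _ (totalProduct R f')) ∘ₗ (LinearMap.llcomp K _ _ _) ∘ₗ (totalProduct R e')
  suffices h : c • L + d • M = 0 from
    congrArg (fun F : TotalSpace R →ₗ[K] TotalSpace R →ₗ[K] TotalSpace R →ₗ[K] TotalSpace R =>
      F x y z) h
  refine totalSpace_hom_ext fun t => totalSpace_hom_ext fun s => totalSpace_hom_ext fun r => ?_
  change c • totalProduct R e (totalProduct R f (totalClass R t) (totalClass R s)) (totalClass R r)
    + d • totalProduct R e' (totalClass R t)
      (totalProduct R f' (totalClass R s) (totalClass R r)) = 0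
  simp only [totalProduct_totalClass]
  set n := t.leaves + s.leaves + r.leaves with hn
  have hl : (PTree.node e (PTree.node f t s) r).leaves = n := by simp only [PTree.leaves, hn]
  have hr' : (PTree.node e' t (PTree.node f' s r)).leaves = n := by
    simp only [PTree.leaves, hn]; omega
  rw [← lof_treeClass R _ hl, ← lof_treeClass R _ hr', ← map_smul, ← map_smul, ← map_add]
  refine (congrArg _ ?_).trans (map_zero _)
  -- The relator is composed with `r`, `s`, `t` at the inputs `2`, `1`, `0`. Starting from the right
  -- leaves the positions of the remaining inputs unchanged.
  have h0 := IdealMem.of (P := freeOperad K E) (S := relators R) (n := 3) _ (mem_relators R hr)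
  have h1 := IdealMem.comp_left (k := r.leaves + 2) (2 : Fin 3) (by omega) _
    (Finsupp.single ⟨r, rfl⟩ 1 : TreeModule K E r.leaves) h0
  have h2 := IdealMem.comp_left (k := s.leaves + r.leaves + 1) (1 : Fin (r.leaves + 2)) (by omega)
    _ (Finsupp.single ⟨s, rfl⟩ 1 : TreeModule K E s.leaves) h1
  have h3 := IdealMem.comp_left (k := n) (0 : Fin (s.leaves + r.leaves + 1)) (by omega)
    _ (Finsupp.single ⟨t, rfl⟩ 1 : TreeModule K E t.leaves) h2
  refine Eq.trans ?_ ((Submodule.Quotient.mk_eq_zero _).2 h3)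
  change _ = Submodule.Quotient.mk (treeComp K _ _ (treeComp K _ _ (treeComp K _ _
    (c • leftComb K e f + d • rightComb K e' f') _) _) _)
  simp only [leftComb, rightComb, map_add, map_smul, LinearMap.add_apply, LinearMap.smul_apply,
    treeComp_single, mul_one]
  simp [graftArity, PTree.graft, PTree.leaves, -Finsupp.smul_single]
  rfl

end TotalSpace

/-! ### The relators of the Koszul dual -/

section Relators

theorem PTree.eq_of_leaves_eq_one {E : Type} {t : PTree E} (h : t.leaves = 1) : t = leaf := by
  cases t with
  | leaf => rfl
  | node e l r =>
    have := l.leaves_pos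
    have := r.leaves_pos
    simp only [leaves] at h
    omega

theorem PTree.eq_of_leaves_eq_two {E : Type} {t : PTree E} (h : t.leaves = 2) :
    ∃ e, t = node e leaf leaf := by
  cases t with
  | leaf => simp [leaves] at h
  | node e l r =>
    have := l.leaves_pos
    have := r.leaves_pos
    simp only [leaves] at h
    rw [eq_of_leaves_eq_one (show l.leaves = 1 by omega),
      eq_of_leaves_eq_one (show r.leaves = 1 by omega)]
    exact ⟨e, rfl⟩

/-- The tree of `(x, y, z) ↦ (x f y) e z`. -/
def leftTree {E : Type} (e f : E) : {t : PTree E // t.leaves = 3} :=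
  ⟨PTree.node e (PTree.node f PTree.leaf PTree.leaf) PTree.leaf, rfl⟩

/-- The tree of `(x, y, z) ↦ x e (y f z)`. -/
def rightTree {E : Type} (e f : E) : {t : PTree E // t.leaves = 3} :=
  ⟨PTree.node e PTree.leaf (PTree.node f PTree.leaf PTree.leaf), rfl⟩

theorem eq_leftTree_or_rightTree {E : Type} (t : {t : PTree E // t.leaves = 3}) :
    (∃ e f, t = leftTree e f) ∨ ∃ e f, t = rightTree e f := by
  obtain ⟨t, ht⟩ := t
  cases t with
  | leaf => simp [PTree.leaves] at ht
  | node e l r =>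
    have h1 := l.leaves_pos
    have h2 := r.leaves_pos
    have h3 := ht
    simp only [PTree.leaves] at h3
    by_cases hl : l.leaves = 1
    · obtain ⟨f, rfl⟩ := PTree.eq_of_leaves_eq_two (show r.leaves = 2 by omega)
      obtain rfl := PTree.eq_of_leaves_eq_one hl
      exact Or.inr ⟨e, f, rfl⟩
    · obtain ⟨f, rfl⟩ := PTree.eq_of_leaves_eq_two (show l.leaves = 2 by omega)
      obtain rfl := PTree.eq_of_leaves_eq_one (show r.leaves = 1 by omega)
      exact Or.inl ⟨e, f, rfl⟩

theorem leftTree_inj {E : Type} {e f e' f' : E} :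
    leftTree e f = leftTree e' f' ↔ e = e' ∧ f = f' :=
  Subtype.ext_iff.trans (by simp [leftTree])

theorem rightTree_inj {E : Type} {e f e' f' : E} :
    rightTree e f = rightTree e' f' ↔ e = e' ∧ f = f' :=
  Subtype.ext_iff.trans (by simp [rightTree])

theorem leftTree_ne_rightTree {E : Type} {e f e' f' : E} : leftTree e f ≠ rightTree e' f' :=
  fun h => by simpa [leftTree, rightTree] using Subtype.ext_iff.1 h

variable {K : Type u} [Field K]

theorem leftComb_eq {E : Type} (e f : E) : leftComb K e f = Finsupp.single (leftTree e f) 1 := rfl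

theorem rightComb_eq {E : Type} (e f : E) :
    rightComb K e f = Finsupp.single (rightTree e f) 1 := rfl

/-- The pairing of the relator `(x f y) e z - x e' (y f' z)` with an element of arity three. -/
theorem pairing_leftComb_sub_rightComb {E : Type} (e f e' f' : E) (x : TreeModule K E 3) :
    Finsupp.linearCombination K (fun t : {t : PTree E // t.leaves = 3} =>
      (t.1.sign : K) * (leftComb K e f - rightComb K e' f') t) x =
      x (leftTree e f) + x (rightTree e' f') := by
  induction x using Finsupp.induction_linear with
  | zero => simp
  | add x y hx hy => rw [map_add, hx, hy, Finsupp.add_apply, Finsupp.add_apply]; ring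
  | single t c =>
    classical
    rw [Finsupp.linearCombination_single, leftComb_eq, rightComb_eq, Finsupp.sub_apply]
    simp only [Finsupp.single_apply]
    rcases eq_leftTree_or_rightTree t with ⟨a, b, rfl⟩ | ⟨a, b, rfl⟩
    · have hs : (leftTree a b).1.sign = 1 := rfl
      simp [hs, leftTree_inj, leftTree_ne_rightTree, leftTree_ne_rightTree.symm, eq_comm]
    · have hs : (rightTree a b).1.sign = -1 := rfl
      simp [hs, rightTree_inj, leftTree_ne_rightTree, leftTree_ne_rightTree.symm, eq_comm]
      split_ifs <;> simp

theorem mem_orthogonal_span {E : Type} {S : Set (TreeModule K E 3)} {x : TreeModule K E 3} :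
    x ∈ orthogonal (Submodule.span K S) ↔ ∀ r ∈ S,
      Finsupp.linearCombination K (fun t : {t : PTree E // t.leaves = 3} =>
        (t.1.sign : K) * r t) x = 0 := by
  simp only [orthogonal, Submodule.mem_iInf, LinearMap.mem_ker]
  refine ⟨fun h r hr => h r (Submodule.subset_span hr), fun h r hr => ?_⟩
  induction hr using Submodule.span_induction with
  | mem r hr => exact h r hr
  | zero => simp [Finsupp.linearCombination_apply]
  | add r s _ _ hr hs =>
    rw [Finsupp.linearCombination_apply] at *
    simp only [Finsupp.add_apply, mul_add, smul_add, Finsupp.sum_add, hr, hs, add_zero]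
  | smul c r _ hr =>
    rw [Finsupp.linearCombination_apply, Finsupp.sum] at *
    simp only [Finsupp.smul_apply, smul_eq_mul, mul_left_comm _ c, ← Finset.mul_sum] at hr ⊢
    rw [hr, mul_zero]

theorem mem_orthogonal_dupRelators {x : TreeModule K DupGen 3} :
    x ∈ orthogonal (dupRelators K) ↔
      x (leftTree .left .left) + x (rightTree .left .left) = 0 ∧
      x (leftTree .left .right) + x (rightTree .right .left) = 0 ∧
      x (leftTree .right .right) + x (rightTree .right .right) = 0 := by
  rw [dupRelators, mem_orthogonal_span]
  simp only [Set.mem_insert_iff, Set.mem_singleton_iff, forall_eq_or_imp, forall_eq,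
    pairing_leftComb_sub_rightComb]

/-- The relators and the pairing are diagonal in the tree basis up to pairing off three left combs
with three right combs. On each pair the orthogonal of `m - m'` is again spanned by `m - m'`, and
the two unpaired combs are orthogonal to everything. -/
theorem orthogonal_dupRelators :
    orthogonal (dupRelators K) = dupRelators K ⊔ dupExtraRelators K := by
  apply le_antisymm
  · intro x hx
    obtain ⟨h1, h2, h3⟩ := mem_orthogonal_dupRelators.1 hx
    -- The coefficients of the three paired right combs are opposite to those of the left combs, so
    -- the latter and the two unpaired coefficients determine `x`.
    have key : x = (x (leftTree .left .left) • (leftComb K .left .left - rightComb K .left .left) +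
        x (leftTree .left .right) • (leftComb K .left .right - rightComb K .right .left) +
        x (leftTree .right .right) • (leftComb K .right .right - rightComb K .right .right)) +
        (x (leftTree .right .left) • leftComb K .right .left +
        x (rightTree .left .right) • rightComb K .left .right) := by
      classical
      ext t
      simp only [leftComb_eq, rightComb_eq, Finsupp.add_apply, Finsupp.smul_apply,
        Finsupp.sub_apply, Finsupp.single_apply]
      rcases eq_leftTree_or_rightTree t with ⟨e, f, rfl⟩ | ⟨e, f, rfl⟩ <;> cases e <;> cases f <;>
        simp [leftTree_inj, rightTree_inj, leftTree_ne_rightTree, leftTree_ne_rightTree.symm,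
          eq_neg_of_add_eq_zero_left h1, eq_neg_of_add_eq_zero_left h2,
          eq_neg_of_add_eq_zero_left h3]
    rw [key]
    refine Submodule.add_mem_sup (add_mem (add_mem ?_ ?_) ?_) (add_mem ?_ ?_) <;>
      exact Submodule.smul_mem _ _ (Submodule.subset_span (by simp))
  · refine sup_le (Submodule.span_le.2 ?_) (Submodule.span_le.2 ?_)
    · rintro _ (rfl | rfl | rfl) <;> refine mem_orthogonal_dupRelators.2 ?_ <;> classical
        simp [leftComb_eq, rightComb_eq, leftTree_inj, rightTree_inj,
          leftTree_ne_rightTree, leftTree_ne_rightTree.symm]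
    · rintro _ (rfl | rfl) <;> refine mem_orthogonal_dupRelators.2 ?_ <;> classical
        simp [leftComb_eq, rightComb_eq, leftTree_inj, rightTree_inj,
          leftTree_ne_rightTree, leftTree_ne_rightTree.symm]

end Relators

/-! ### Algebras over the Koszul dual -/

section Algebras

variable {K : Type u} [Field K]

theorem isAlgebraOfType_iff {E : Type} {R : Submodule K (TreeModule K E 3)} {A : Type w}
    [AddCommGroup A] [Module K A] {op : E → A →ₗ[K] A →ₗ[K] A} :
    IsAlgebraOfType R op ↔ ∀ a, R ≤ LinearMap.ker (evalTree op a 3) :=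
  ⟨fun h a r hr => h r hr a, fun h _ hr a => h a hr⟩

theorem evalTree_leftComb {E : Type} {A : Type w} [AddCommGroup A] [Module K A]
    (op : E → A →ₗ[K] A →ₗ[K] A) (a : ℕ → A) (e f : E) :
    evalTree op a 3 (leftComb K e f) = op e (op f (a 0) (a 1)) (a 2) :=
  (evalTree_single op a 3 _ 1).trans (one_smul K _)

theorem evalTree_rightComb {E : Type} {A : Type w} [AddCommGroup A] [Module K A]
    (op : E → A →ₗ[K] A →ₗ[K] A) (a : ℕ → A) (e f : E) :
    evalTree op a 3 (rightComb K e f) = op e (a 0) (op f (a 1) (a 2)) :=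
  (evalTree_single op a 3 _ 1).trans (one_smul K _)

theorem forall_nat_fun_three {A : Type w} [Zero A] {p : A → A → A → Prop} :
    (∀ a : ℕ → A, p (a 0) (a 1) (a 2)) ↔ ∀ x y z, p x y z :=
  ⟨fun h x y z => h fun n => match n with
    | 0 => x
    | 1 => y
    | _ => z, fun h _ => h _ _ _⟩

theorem isAlgebraOfType_dupRelators_iff {A : Type w} [AddCommGroup A] [Module K A]
    {op : DupGen → A →ₗ[K] A →ₗ[K] A} :
    IsAlgebraOfType (dupRelators K) op ↔ ∃ D : DuplicialAlgebra K A, D.op = op := by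
  have h1 : IsAlgebraOfType (dupRelators K) op ↔ ∀ x y z : A,
      (op .left (op .left x y) z = op .left x (op .left y z)) ∧
      (op .left (op .right x y) z = op .right x (op .left y z)) ∧
      (op .right (op .right x y) z = op .right x (op .right y z)) := by
    rw [isAlgebraOfType_iff, ← forall_nat_fun_three]
    refine forall_congr' fun a => ?_
    rw [dupRelators, Submodule.span_le]
    simp [Set.insert_subset_iff, evalTree_leftComb, evalTree_rightComb, sub_eq_zero]
  rw [h1]
  constructor
  · intro h
    refine ⟨⟨op .left, op .right, fun x y z => (h x y z).1, fun x y z => (h x y z).2.1,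
      fun x y z => (h x y z).2.2⟩, ?_⟩
    funext e
    cases e <;> rfl
  · rintro ⟨D, rfl⟩ x y z
    exact ⟨D.left_left x y z, D.right_left x y z, D.right_right x y z⟩

theorem isAlgebraOfType_orthogonal_dupRelators_iff {A : Type w} [AddCommGroup A] [Module K A]
    {op : DupGen → A →ₗ[K] A →ₗ[K] A} :
    IsAlgebraOfType (orthogonal (dupRelators K)) op ↔ ∃ D : DuplicialAlgebra K A, D.op = op ∧
      (∀ x y z : A, D.right (D.left x y) z = 0) ∧ ∀ x y z : A, D.left x (D.right y z) = 0 := by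
  have h1 : IsAlgebraOfType (orthogonal (dupRelators K)) op ↔
      IsAlgebraOfType (dupRelators K) op ∧ ∀ x y z : A,
        (op .right (op .left x y) z = 0) ∧ op .left x (op .right y z) = 0 := by
    rw [isAlgebraOfType_iff, isAlgebraOfType_iff, ← forall_nat_fun_three, ← forall_and,
      orthogonal_dupRelators]
    refine forall_congr' fun a => ?_
    rw [sup_le_iff, dupExtraRelators]
    refine and_congr_right fun _ => ?_
    rw [Submodule.span_le]
    simp [Set.insert_subset_iff, evalTree_leftComb, evalTree_rightComb]
  rw [h1, isAlgebraOfType_dupRelators_iff]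
  constructor
  · rintro ⟨⟨D, rfl⟩, h⟩
    exact ⟨D, rfl, fun x y z => (h x y z).1, fun x y z => (h x y z).2⟩
  · rintro ⟨D, rfl, h2, h3⟩
    exact ⟨⟨D, rfl⟩, fun x y z => ⟨h2 x y z, h3 x y z⟩⟩

end Algebras

/-! ### The operations of the Koszul dual of the duplicial operad -/

section DualBasis

variable (K : Type u) [Field K]

/-- The total space of an operad of type `R ≥ dupRelators` is a duplicial algebra. -/
def totalDuplicial {R : Submodule K (TreeModule K DupGen 3)} (hR : dupRelators K ≤ R) :
    DuplicialAlgebra K (TotalSpace R) where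
  left := totalProduct R .left
  right := totalProduct R .right
  left_left x y z := by
    have := totalProduct_relation R (c := 1) (d := -1) (e := .left) (f := .left) (e' := .left)
      (f' := .left) (hR (Submodule.subset_span (by simp [sub_eq_add_neg]))) x y z
    simpa [add_neg_eq_zero] using this
  right_left x y z := by
    have := totalProduct_relation R (c := 1) (d := -1) (e := .left) (f := .right) (e' := .right)
      (f' := .left) (hR (Submodule.subset_span (by simp [sub_eq_add_neg]))) x y z
    simpa [add_neg_eq_zero] using this
  right_right x y z := by
    have := totalProduct_relation R (c := 1) (d := -1) (e := .right) (f := .right) (e' := .right)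
      (f' := .right) (hR (Submodule.subset_span (by simp [sub_eq_add_neg]))) x y z
    simpa [add_neg_eq_zero] using this

theorem totalDuplicial_op {R : Submodule K (TreeModule K DupGen 3)} (hR : dupRelators K ≤ R) :
    (totalDuplicial K hR).op = totalProduct R := by
  funext e
  cases e <;> rfl

theorem dupRelators_le_orthogonal : dupRelators K ≤ orthogonal (dupRelators K) :=
  le_sup_left.trans orthogonal_dupRelators.ge

/-- The class of a tree in the sum of all the spaces of operations of the Koszul dual. -/
abbrev dualClass (t : PTree DupGen) : TotalSpace (orthogonal (dupRelators K)) :=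
  totalClass (orthogonal (dupRelators K)) t

/-- The duplicial algebra formed by the operations of the Koszul dual. -/
abbrev dualAlg : DuplicialAlgebra K (TotalSpace (orthogonal (dupRelators K))) :=
  totalDuplicial K (dupRelators_le_orthogonal K)

theorem dualAlg_left_right (x y z : TotalSpace (orthogonal (dupRelators K))) :
    (dualAlg K).right ((dualAlg K).left x y) z = 0 := by
  -- With `d = 0` only the left comb counts, and the labels `e'`, `f'` are arbitrary.
  have := totalProduct_relation (orthogonal (dupRelators K)) (c := 1) (d := 0) (e := .right)
    (f := .left) (e' := .left) (f' := .left) (by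
      rw [orthogonal_dupRelators]
      exact Submodule.mem_sup_right (Submodule.subset_span (by simp))) x y z
  simp only [one_smul, zero_smul, add_zero] at this
  exact this

theorem dualAlg_right_left (x y z : TotalSpace (orthogonal (dupRelators K))) :
    (dualAlg K).left x ((dualAlg K).right y z) = 0 := by
  have := totalProduct_relation (orthogonal (dupRelators K)) (c := 0) (d := 1) (e := .right)
    (f := .left) (e' := .left) (f' := .right) (by
      rw [orthogonal_dupRelators]
      exact Submodule.mem_sup_right (Submodule.subset_span (by simp))) x y z
  simp only [one_smul, zero_smul, zero_add] at this
  exact this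

theorem dualClass_node_left (t s : PTree DupGen) :
    dualClass K (.node .left t s) = (dualAlg K).left (dualClass K t) (dualClass K s) :=
  (totalProduct_totalClass _ _ t s).symm

theorem dualClass_node_right (t s : PTree DupGen) :
    dualClass K (.node .right t s) = (dualAlg K).right (dualClass K t) (dualClass K s) :=
  (totalProduct_totalClass _ _ t s).symm

/-- The class of the monomial `x ≻ ⋯ ≻ x ≺ ⋯ ≺ x`. -/
abbrev dualMon (p q : ℕ) : TotalSpace (orthogonal (dupRelators K)) := dualClass K (dupMonomial p q)

/-! ### Products of the monomials of the Koszul dual, and insertion of generators into them -/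

theorem dualClass_leaf : dualClass K .leaf = dualMon K 0 0 := by
  rw [dualMon, dupMonomial]

theorem dualMon_succ_left (p q : ℕ) :
    dualMon K (p + 1) q = (dualAlg K).right (dualMon K 0 0) (dualMon K p q) := by
  rw [dualMon, dupMonomial, dualClass_node_right, dualClass_leaf]

/-- The mixed axiom `(x ≻ y) ≺ z = x ≻ (y ≺ z)` makes it possible to peel off a `≺` on the right
although the monomial is built with its `≻` outermost. -/
theorem dualMon_succ_right (p q : ℕ) :
    dualMon K p (q + 1) = (dualAlg K).left (dualMon K p q) (dualMon K 0 0) := by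
  induction p with
  | zero => rw [dualMon, dupMonomial, dualClass_node_left, dualClass_leaf]
  | succ p ih => rw [dualMon_succ_left, ih, ← DuplicialAlgebra.right_left, ← dualMon_succ_left]

theorem right_dualMon_zero (p p' q : ℕ) :
    (dualAlg K).right (dualMon K p 0) (dualMon K p' q) = dualMon K (p + p' + 1) q := by
  induction p with
  | zero => rw [zero_add, ← dualMon_succ_left]
  | succ p ih =>
    rw [dualMon_succ_left, DuplicialAlgebra.right_right, ih, ← dualMon_succ_left]
    congr 2
    omega

theorem right_dualMon_succ (p q : ℕ) (z : TotalSpace (orthogonal (dupRelators K))) :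
    (dualAlg K).right (dualMon K p (q + 1)) z = 0 := by
  rw [dualMon_succ_right, dualAlg_left_right]

theorem left_dualMon_zero (p q q' : ℕ) :
    (dualAlg K).left (dualMon K p q) (dualMon K 0 q') = dualMon K p (q + q' + 1) := by
  induction q' with
  | zero => rw [add_zero, ← dualMon_succ_right]
  | succ q' ih =>
    rw [dualMon_succ_right K 0, ← DuplicialAlgebra.left_left, ih, ← dualMon_succ_right]
    congr 2

theorem left_dualMon_succ (p q : ℕ) (z : TotalSpace (orthogonal (dupRelators K))) :
    (dualAlg K).left z (dualMon K (p + 1) q) = 0 := by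
  rw [dualMon_succ_left, dualAlg_right_left]

/-- The monomials and zero are closed under both products: a `≺` in the left factor of `≻`, or a `≻`
in the right factor of `≺`, gives zero, and otherwise the operation symbols are concatenated. This
is the spanning half of `monBasis`. -/
theorem dualClass_eq_zero_or_dualMon (t : PTree DupGen) :
    dualClass K t = 0 ∨ ∃ p q, p + q + 1 = t.leaves ∧ dualClass K t = dualMon K p q := by
  induction t with
  | leaf => exact Or.inr ⟨0, 0, rfl, dualClass_leaf K⟩
  | node e l r hl hr =>
    cases e with
    | left =>
      rw [dualClass_node_left]
      rcases hl with hl | ⟨p, q, h, hl⟩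
      · exact Or.inl (by rw [hl, map_zero, LinearMap.zero_apply])
      rcases hr with hr | ⟨_ | p', q', h', hr⟩
      · exact Or.inl (by rw [hr, map_zero])
      · refine Or.inr ⟨p, q + q' + 1, ?_, by rw [hl, hr, left_dualMon_zero]⟩
        simp only [PTree.leaves]; omega
      · exact Or.inl (by rw [hr, left_dualMon_succ])
    | right =>
      rw [dualClass_node_right]
      rcases hr with hr | ⟨p', q', h', hr⟩
      · exact Or.inl (by rw [hr, map_zero])
      rcases hl with hl | ⟨p, _ | q, h, hl⟩
      · exact Or.inl (by rw [hl, map_zero, LinearMap.zero_apply])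
      · refine Or.inr ⟨p + p' + 1, q', ?_, by rw [hl, hr, right_dualMon_zero]⟩
        simp only [PTree.leaves]; omega
      · exact Or.inl (by rw [hl, right_dualMon_succ])

/-- The first `p + 1` inputs are separated by `≻`, so an extra `≻` fits there. A later input is the
right argument of some `≺`, and `x ≺ (y ≻ z) = 0`. -/
theorem dualClass_graft_right (p q i : ℕ) (hi : i < p + q + 1) :
    dualClass K ((dupMonomial p q).graft i (.node .right .leaf .leaf)) =
      if i ≤ p then dualMon K (p + 1) q else 0 := by
  induction p generalizing i with
  | zero =>
    induction q with
    | zero =>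
      obtain rfl : i = 0 := by omega
      rw [dupMonomial, PTree.graft, dualClass_node_right, dualClass_leaf, ← dualMon_succ_left,
        if_pos le_rfl]
    | succ q ih =>
      rw [dupMonomial, PTree.graft, leaves_dupMonomial]
      by_cases h : i < 0 + q + 1
      · rw [if_pos h, dualClass_node_left, ih h]
        split_ifs
        · rw [dualMon_succ_right, dualClass_leaf]
        · rw [map_zero, LinearMap.zero_apply]
      · rw [if_neg h, dualClass_node_left, if_neg (by omega)]
        rw [PTree.graft, dualClass_node_right, dualClass_leaf, ← dualMon_succ_left]
        exact left_dualMon_succ K 0 0 _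
  | succ p ih =>
    rw [dupMonomial, PTree.graft, PTree.leaves]
    by_cases h : i < 1
    · obtain rfl : i = 0 := by omega
      rw [if_pos h, dualClass_node_right, if_pos (by omega)]
      rw [PTree.graft, dualClass_node_right, dualClass_leaf, DuplicialAlgebra.right_right,
        ← dualMon_succ_left, ← dualMon_succ_left]
    · rw [if_neg h, dualClass_node_right, ih _ (by omega)]
      split_ifs
      · rw [dualMon_succ_left K (p + 1), dualClass_leaf]
      · omega
      · omega
      · rw [map_zero]

/-- An input before the `p`-th is the left argument of some `≻`, and `(x ≺ y) ≻ z = 0`. The input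
`p` itself accepts both generators, which is why the ranges of `d^h` and `d^v` overlap there. -/
theorem dualClass_graft_left (p q i : ℕ) (hi : i < p + q + 1) :
    dualClass K ((dupMonomial p q).graft i (.node .left .leaf .leaf)) =
      if p ≤ i then dualMon K p (q + 1) else 0 := by
  induction p generalizing i with
  | zero =>
    rw [if_pos (Nat.zero_le _)]
    induction q with
    | zero =>
      obtain rfl : i = 0 := by omega
      rw [dupMonomial, PTree.graft, dualClass_node_left, dualClass_leaf, ← dualMon_succ_right]
    | succ q ih =>
      rw [dupMonomial, PTree.graft, leaves_dupMonomial]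
      by_cases h : i < 0 + q + 1
      · rw [if_pos h, dualClass_node_left, ih h, dualMon_succ_right K 0 (q + 1),
          dualClass_leaf]
      · rw [if_neg h, dualClass_node_left]
        rw [PTree.graft, dualClass_node_left, dualClass_leaf, ← DuplicialAlgebra.left_left,
          ← dualMon_succ_right, ← dualMon_succ_right]
  | succ p ih =>
    rw [dupMonomial, PTree.graft, PTree.leaves]
    by_cases h : i < 1
    · obtain rfl : i = 0 := by omega
      rw [if_pos h, dualClass_node_right, if_neg (by omega)]
      rw [PTree.graft, dualClass_node_left, dualAlg_left_right]
    · rw [if_neg h, dualClass_node_right, ih _ (by omega)]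
      split_ifs
      · rw [dualMon_succ_left K p, dualClass_leaf]
      · omega
      · omega
      · rw [map_zero]

-- Identities are computed in the total space, where no arity has to be matched, and are brought
-- back to a fixed arity by the injectivity of the inclusion of a summand.
variable {K} in
theorem treeClass_eq_of_totalClass_eq {E : Type} {R : Submodule K (TreeModule K E 3)} {n : ℕ}
    {t s : PTree E} (ht : t.leaves = n) (hs : s.leaves = n)
    (h : totalClass R t = totalClass R s) : treeClass R t ht = treeClass R s hs := by
  rw [← lof_treeClass R t ht, ← lof_treeClass R s hs] at h
  exact DirectSum.of_injective (β := fun n => (quadraticOperad R).Op n) n h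

variable {K} in
theorem treeClass_eq_zero_of_totalClass_eq {E : Type} {R : Submodule K (TreeModule K E 3)} {n : ℕ}
    {t : PTree E} (ht : t.leaves = n) (h : totalClass R t = 0) : treeClass R t ht = 0 := by
  rw [← lof_treeClass R t ht] at h
  exact DirectSum.of_injective (β := fun n => (quadraticOperad R).Op n) n
    (h.trans (map_zero _).symm)

/-- The monomial `x ≻ ⋯ ≻ x ≺ ⋯ ≺ x` as an operation of the Koszul dual. -/
def monOp (p q : ℕ) {n : ℕ} (h : p + q + 1 = n) : (koszulDual (dupRelators K)).Op n :=
  treeClass (orthogonal (dupRelators K)) (dupMonomial p q) ((leaves_dupMonomial p q).trans h)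

theorem insertGenerator_right_monOp (p q : ℕ) {n : ℕ} (h : p + q + 1 = n) (i : Fin n) :
    insertGenerator (dupRelators K) .right i (monOp K p q h) =
      if (i : ℕ) ≤ p then monOp K (p + 1) q (by omega) else 0 := by
  have hi : (i : ℕ) < p + q + 1 := h ▸ i.2
  have hl : ((dupMonomial p q).graft i (.node .right .leaf .leaf)).leaves = n + 1 := by
    have := PTree.leaves_graft (dupMonomial p q) (.node .right .leaf .leaf) i
      (by rwa [leaves_dupMonomial])
    rw [leaves_dupMonomial] at this
    simp only [PTree.leaves] at this
    omega
  have h1 := dualClass_graft_right K p q i hi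
  refine (comp_treeClass _ i _ ((leaves_dupMonomial p q).trans h) rfl hl).trans ?_
  split_ifs at h1 ⊢
  · exact treeClass_eq_of_totalClass_eq _ _ h1
  · exact treeClass_eq_zero_of_totalClass_eq _ h1

theorem insertGenerator_left_monOp (p q : ℕ) {n : ℕ} (h : p + q + 1 = n) (i : Fin n) :
    insertGenerator (dupRelators K) .left i (monOp K p q h) =
      if p ≤ (i : ℕ) then monOp K p (q + 1) (by omega) else 0 := by
  have hi : (i : ℕ) < p + q + 1 := h ▸ i.2
  have hl : ((dupMonomial p q).graft i (.node .left .leaf .leaf)).leaves = n + 1 := by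
    have := PTree.leaves_graft (dupMonomial p q) (.node .left .leaf .leaf) i
      (by rwa [leaves_dupMonomial])
    rw [leaves_dupMonomial] at this
    simp only [PTree.leaves] at this
    omega
  have h1 := dualClass_graft_left K p q i hi
  refine (comp_treeClass _ i _ ((leaves_dupMonomial p q).trans h) rfl hl).trans ?_
  split_ifs at h1 ⊢
  · exact treeClass_eq_of_totalClass_eq _ _ h1
  · exact treeClass_eq_zero_of_totalClass_eq _ h1

/-! ### A polynomial model which separates the monomials -/

variable {K} in
/-- The duplicial algebra with `x ≻ y = s φ(x) y` and `x ≺ y = t x ψ(y)`, where `φ` and `ψ` are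
idempotent endomorphisms which fix `s` and `t`, respectively. -/
def twistedDuplicial {B : Type w} [CommRing B] [Algebra K B] (s t : B) (φ ψ : B →ₐ[K] B)
    (hφ : ∀ x, φ (φ x) = φ x) (hψ : ∀ x, ψ (ψ x) = ψ x) (hs : φ s = s) (ht : ψ t = t) :
    DuplicialAlgebra K B where
  left := (LinearMap.mul K B ∘ₗ LinearMap.mulLeft K t).compl₂ ψ.toLinearMap
  right := LinearMap.mul K B ∘ₗ LinearMap.mulLeft K s ∘ₗ φ.toLinearMap
  left_left x y z := by
    simp [hψ, ht]
    ring
  right_left x y z := by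
    simp
    ring
  right_right x y z := by
    simp [hφ, hs]
    ring

open MvPolynomial in
/-- The duplicial algebra `K[s, t]` with `x ≻ y = s x(s, 0) y` and `x ≺ y = t x y(0, t)`, where
`s = X true` and `t = X false`. -/
def polyAlg : DuplicialAlgebra K (MvPolynomial Bool K) :=
  twistedDuplicial (X true) (X false)
    (aeval fun b => bif b then (X true : MvPolynomial Bool K) else 0)
    (aeval fun b => bif b then (0 : MvPolynomial Bool K) else X false)
    (fun x => by
      rw [← AlgHom.comp_apply]
      congr 1
      ext b
      cases b <;> simp)
    (fun x => by
      rw [← AlgHom.comp_apply]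
      congr 1
      ext b
      cases b <;> simp) (by simp) (by simp)

/-- A product by `≺` is divisible by `t`, which the left argument of `≻` sets to zero. A product by
`≻` is divisible by `s`, which the right argument of `≺` sets to zero. -/
theorem isAlgebraOfType_polyAlg :
    IsAlgebraOfType (orthogonal (dupRelators K)) (polyAlg K).op :=
  isAlgebraOfType_orthogonal_dupRelators_iff.2 ⟨polyAlg K, rfl,
    fun x y z => by simp [polyAlg, twistedDuplicial],
    fun x y z => by simp [polyAlg, twistedDuplicial]⟩

-- The monomials of the Koszul dual take linearly independent values, so they are themselves
-- independent.
open MvPolynomial in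
theorem eval_dupMonomial (p q : ℕ) :
    (dupMonomial p q).eval (fun e x y => (polyAlg K).op e x y) (fun _ => 1) =
      X true ^ p * X false ^ q := by
  induction p with
  | zero =>
    induction q with
    | zero => simp [dupMonomial, PTree.eval]
    | succ q ih =>
      rw [dupMonomial, PTree.eval, ih]
      simp [PTree.eval, DuplicialAlgebra.op, polyAlg, twistedDuplicial]
      ring
  | succ p ih =>
    rw [dupMonomial, PTree.eval, ih]
    simp [PTree.eval, DuplicialAlgebra.op, polyAlg, twistedDuplicial]
    ring

/-- The functional dual to a monomial of the Koszul dual. -/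
def monDual (p n : ℕ) : (koszulDual (dupRelators K)).Op (n + 1) →ₗ[K] K :=
  MvPolynomial.lcoeff K (Finsupp.single true p + Finsupp.single false (n - p)) ∘ₗ
    evalOp (isAlgebraOfType_polyAlg K) (fun _ => 1) (n + 1)

theorem monDual_monOp (p p' q n : ℕ) (h : p' + q + 1 = n + 1) :
    monDual K p n (monOp K p' q h) = if p' = p then 1 else 0 := by
  have h1 : monDual K p n (monOp K p' q h) =
      MvPolynomial.coeff (Finsupp.single true p + Finsupp.single false (n - p))
        ((dupMonomial p' q).eval (fun e x y => (polyAlg K).op e x y) (fun _ => 1)) :=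
    congrArg (MvPolynomial.coeff (Finsupp.single true p + Finsupp.single false (n - p)))
      (evalOp_treeClass (isAlgebraOfType_polyAlg K) (fun _ => 1) (dupMonomial p' q) _)
  rw [h1, eval_dupMonomial, MvPolynomial.X_pow_eq_monomial, MvPolynomial.X_pow_eq_monomial,
    MvPolynomial.monomial_mul, MvPolynomial.coeff_monomial, mul_one]
  congr 1
  rw [eq_iff_iff]
  constructor
  · intro h2
    simpa using DFunLike.congr_fun h2 true
  · rintro rfl
    rw [show q = n - p' by omega]

/-- The basis of `Dup^!_{n+1}` formed by the monomials `x ≻ ⋯ ≻ x ≺ ⋯ ≺ x`. -/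
def monBasis (n : ℕ) : Module.Basis (Fin (n + 1)) K ((koszulDual (dupRelators K)).Op (n + 1)) :=
  Module.Basis.mk (v := fun p : Fin (n + 1) => monOp K p (n - p) (by omega))
    (by
      -- The functionals `monDual` carry the family to the standard basis of `K ^ (n + 1)`.
      refine LinearIndependent.of_comp (LinearMap.pi fun p : Fin (n + 1) => monDual K p n) ?_
      have : (LinearMap.pi fun p : Fin (n + 1) => monDual K p n) ∘
          (fun p : Fin (n + 1) => monOp K p (n - p) (by omega)) = Pi.basisFun K (Fin (n + 1)) := by
        funext p
        ext p'
        simp [monDual_monOp, Pi.single_apply, Fin.ext_iff, eq_comm]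
      rw [this]
      exact (Pi.basisFun K (Fin (n + 1))).linearIndependent)
    (by
      -- Spanning means that the projection modulo the span vanishes, which can be tested on the
      -- classes of trees.
      rw [top_le_iff, ← Submodule.ker_mkQ (Submodule.span K _), LinearMap.ker_eq_top]
      refine op_hom_ext fun t ht => ?_
      refine (Submodule.Quotient.mk_eq_zero _).2 ?_
      rcases dualClass_eq_zero_or_dualMon K t with h | ⟨p, q, h, h'⟩
      · rw [treeClass_eq_zero_of_totalClass_eq ht h]
        exact zero_mem _
      · have hp : q = n - p := by omega
        subst hp
        refine Submodule.subset_span ⟨⟨p, by omega⟩, ?_⟩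
        exact (treeClass_eq_of_totalClass_eq _ _ h').symm)

theorem monBasis_apply (n : ℕ) (p : Fin (n + 1)) :
    monBasis K n p = monOp K p (n - p) (by omega) :=
  Module.Basis.mk_apply _ _ _

end DualBasis

/-! ### Tensor powers -/

section TensorPowers

variable {K : Type u} [Field K] {A : Type w} [AddCommGroup A] [Module K A]

/-- The map `a, u ↦ a ⊗ u` on tensor powers. -/
def tcons (k : ℕ) : A →ₗ[K] (⨂[K] _ : Fin k, A) →ₗ[K] ⨂[K] _ : Fin (k + 1), A :=
  (PiTensorProduct.lift (R := K) (s := fun _ : Fin k => A)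
      (E := ⨂[K] _ : Fin (k + 1), A)).toLinearMap ∘ₗ
    (PiTensorProduct.tprod K (s := fun _ : Fin (k + 1) => A)).curryLeft

theorem tcons_tprod (k : ℕ) (a : A) (v : Fin k → A) :
    tcons k a (PiTensorProduct.tprod K v) =
      PiTensorProduct.tprod K (Fin.cons a v : Fin (k + 1) → A) := by
  simp [tcons]

theorem tprod_eq_tcons (k : ℕ) (v : Fin (k + 1) → A) :
    PiTensorProduct.tprod K v = tcons k (v 0) (PiTensorProduct.tprod K (Fin.tail v)) := by
  rw [tcons_tprod, Fin.cons_self_tail]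

variable {N : Type v} [AddCommGroup N] [Module K N]

theorem tensorPower_hom_ext {k : ℕ} {f g : (⨂[K] _ : Fin (k + 1), A) →ₗ[K] N}
    (h : ∀ a u, f (tcons k a u) = g (tcons k a u)) : f = g := by
  refine PiTensorProduct.ext (MultilinearMap.ext fun v => ?_)
  simp only [LinearMap.compMultilinearMap_apply, tprod_eq_tcons, h]

/-- Scalars are absorbed in the factor `u`, so additivity and the elements `a ⊗ u` suffice. -/
theorem tensorPower_induction {k : ℕ} {p : (⨂[K] _ : Fin (k + 1), A) → Prop}
    (hadd : ∀ x y, p x → p y → p (x + y)) (hcons : ∀ a u, p (tcons k a u)) (x) : p x := by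
  induction x using PiTensorProduct.induction_on with
  | smul_tprod r v =>
    rw [tprod_eq_tcons, ← map_smul]
    exact hcons _ _
  | add x y hx hy => exact hadd x y hx hy

/-- The linear map defined on a tensor power by its values on the elements `a ⊗ u`. -/
def tuncons (k : ℕ) (β : A →ₗ[K] (⨂[K] _ : Fin k, A) →ₗ[K] N) :
    (⨂[K] _ : Fin (k + 1), A) →ₗ[K] N :=
  PiTensorProduct.lift (LinearMap.uncurryLeft (M := fun _ : Fin (k + 1) => A)
    ((PiTensorProduct.lift (R := K) (s := fun _ : Fin k => A) (E := N)).symm.toLinearMap ∘ₗ β))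

theorem tuncons_tcons (k : ℕ) (β : A →ₗ[K] (⨂[K] _ : Fin k, A) →ₗ[K] N) (a : A)
    (u : ⨂[K] _ : Fin k, A) : tuncons k β (tcons k a u) = β a u := by
  have : tuncons k β ∘ₗ tcons k a = β a := by
    refine PiTensorProduct.ext (MultilinearMap.ext fun v => ?_)
    simp [tcons_tprod, tuncons]
  exact LinearMap.congr_fun this u

/-- The multiplication of the first factor by `a` on the left. -/
def act (μ : A →ₗ[K] A →ₗ[K] A) (k : ℕ) (a : A) :
    (⨂[K] _ : Fin (k + 1), A) →ₗ[K] ⨂[K] _ : Fin (k + 1), A :=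
  tuncons k (tcons k ∘ₗ μ a)

theorem act_tcons (μ : A →ₗ[K] A →ₗ[K] A) (k : ℕ) (a b : A) (u : ⨂[K] _ : Fin k, A) :
    act μ k a (tcons k b u) = tcons k (μ a b) u := by
  rw [act, tuncons_tcons, LinearMap.comp_apply]

/-! ### Faces of tensor powers and their alternating sums -/

theorem face_tprod (μ : A →ₗ[K] A →ₗ[K] A) {k : ℕ} (i : Fin k) (v : Fin (k + 1) → A) :
    face μ rfl i (PiTensorProduct.tprod K v) = PiTensorProduct.tprod K
      (Fin.contractNth i.castSucc (fun x y => μ x y) v) :=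
  PiTensorProduct.lift.tprod _

theorem face_zero_tcons (μ : A →ₗ[K] A →ₗ[K] A) {k : ℕ} (a : A) (u : ⨂[K] _ : Fin (k + 1), A) :
    face μ rfl (0 : Fin (k + 1)) (tcons (k + 1) a u) = act μ k a u := by
  have : face μ rfl (0 : Fin (k + 1)) ∘ₗ tcons (k + 1) a = act μ k a := by
    refine PiTensorProduct.ext (MultilinearMap.ext fun v => ?_)
    simp only [LinearMap.compMultilinearMap_apply, LinearMap.comp_apply, tcons_tprod, face_tprod,
      tprod_eq_tcons k v]
    rw [← tcons_tprod k (v 0), act_tcons, tcons_tprod]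
    congr 1
    funext j
    refine Fin.cases ?_ (fun j => ?_) j
    · simp [Fin.contractNth, Fin.cons]
      rfl
    · simp [Fin.contractNth, Fin.tail]
  exact LinearMap.congr_fun this u

theorem face_succ_tcons (μ : A →ₗ[K] A →ₗ[K] A) {k : ℕ} (i : Fin k) (a : A)
    (u : ⨂[K] _ : Fin (k + 1), A) :
    face μ rfl i.succ (tcons (k + 1) a u) = tcons k a (face μ rfl i u) := by
  have : face μ rfl i.succ ∘ₗ tcons (k + 1) a = tcons k a ∘ₗ face μ rfl i := by
    refine PiTensorProduct.ext (MultilinearMap.ext fun v => ?_)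
    simp only [LinearMap.compMultilinearMap_apply, LinearMap.comp_apply, tcons_tprod, face_tprod]
    congr 1
    funext j
    refine Fin.cases ?_ (fun j => ?_) j
    · simp [Fin.contractNth]
    · simp [Fin.contractNth]
  exact LinearMap.congr_fun this u

/-- The alternating sum of the faces of index less than `p`. -/
def facesBelow (μ : A →ₗ[K] A →ₗ[K] A) (p k : ℕ) :
    (⨂[K] _ : Fin (k + 1), A) →ₗ[K] ⨂[K] _ : Fin k, A :=
  ∑ i : Fin k, if (i : ℕ) < p then (-1 : K) ^ (i : ℕ) • face μ rfl i else 0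

/-- The alternating sum of the faces of index at least `p`. -/
def facesAbove (μ : A →ₗ[K] A →ₗ[K] A) (p k : ℕ) :
    (⨂[K] _ : Fin (k + 1), A) →ₗ[K] ⨂[K] _ : Fin k, A :=
  ∑ i : Fin k, if p ≤ (i : ℕ) then (-1 : K) ^ (i : ℕ) • face μ rfl i else 0

theorem facesBelow_zero (μ : A →ₗ[K] A →ₗ[K] A) (k : ℕ) : facesBelow μ 0 k = 0 := by
  simp [facesBelow]

theorem facesBelow_zero_right (μ : A →ₗ[K] A →ₗ[K] A) (p : ℕ) : facesBelow μ p 0 = 0 := by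
  simp [facesBelow]

theorem facesAbove_zero_right (μ : A →ₗ[K] A →ₗ[K] A) (p : ℕ) : facesAbove μ p 0 = 0 := by
  simp [facesAbove]

/-- The face `0` multiplies `a` into `u`. The other faces act on `u` with their index lowered by
one, hence the sign. This recursion and its analogues for `facesAbove` reduce the identities below
to inductions on tensors. -/
theorem facesBelow_succ_tcons (μ : A →ₗ[K] A →ₗ[K] A) (p k : ℕ) (a : A)
    (u : ⨂[K] _ : Fin (k + 1), A) :
    facesBelow μ (p + 1) (k + 1) (tcons (k + 1) a u) =
      act μ k a u - tcons k a (facesBelow μ p k u) := by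
  simp only [facesBelow, Fin.sum_univ_succ, LinearMap.add_apply, LinearMap.sum_apply, map_sum,
    sub_eq_add_neg, ← Finset.sum_neg_distrib]
  congr 1
  · simp [face_zero_tcons]
  · refine Finset.sum_congr rfl fun i _ => ?_
    simp only [Fin.val_succ, Nat.add_lt_add_iff_right]
    split_ifs
    · simp [face_succ_tcons, pow_succ]
    · simp

theorem facesAbove_succ_tcons (μ : A →ₗ[K] A →ₗ[K] A) (p k : ℕ) (a : A)
    (u : ⨂[K] _ : Fin (k + 1), A) :
    facesAbove μ (p + 1) (k + 1) (tcons (k + 1) a u) = -tcons k a (facesAbove μ p k u) := by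
  simp only [facesAbove, Fin.sum_univ_succ, LinearMap.add_apply, LinearMap.sum_apply, map_sum,
    ← Finset.sum_neg_distrib]
  rw [if_neg (by simp), LinearMap.zero_apply, zero_add]
  refine Finset.sum_congr rfl fun i _ => ?_
  simp only [Fin.val_succ, Nat.add_le_add_iff_right]
  split_ifs
  · simp [face_succ_tcons, pow_succ]
  · simp

theorem facesAbove_zero_tcons (μ : A →ₗ[K] A →ₗ[K] A) (k : ℕ) (a : A)
    (u : ⨂[K] _ : Fin (k + 1), A) :
    facesAbove μ 0 (k + 1) (tcons (k + 1) a u) =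
      act μ k a u - tcons k a (facesAbove μ 0 k u) := by
  simp only [facesAbove, Fin.sum_univ_succ, LinearMap.add_apply, LinearMap.sum_apply, map_sum,
    sub_eq_add_neg, ← Finset.sum_neg_distrib, Nat.zero_le, if_true]
  congr 1
  · simp [face_zero_tcons]
  · refine Finset.sum_congr rfl fun i _ => ?_
    simp [face_succ_tcons, pow_succ]

/-! ### The bicomplex relations -/

/-- Expanding both factors on `a ⊗ u`, the inductive hypothesis removes one term, and the two others
cancel because the differential commutes with the left action of `a`. That commutation is
associativity. -/
theorem facesBelow_facesBelow {μ : A →ₗ[K] A →ₗ[K] A} (hμ : ∀ x y z, μ (μ x y) z = μ x (μ y z))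
    (p k : ℕ) : facesBelow μ p k ∘ₗ facesBelow μ (p + 1) (k + 1) = 0 := by
  induction p generalizing k with
  | zero => rw [facesBelow_zero, LinearMap.zero_comp]
  | succ p ih =>
    cases k with
    | zero => rw [facesBelow_zero_right, LinearMap.zero_comp]
    | succ k =>
      refine tensorPower_hom_ext fun a u => ?_
      have hu := LinearMap.congr_fun (ih k) u
      simp only [LinearMap.comp_apply, LinearMap.zero_apply] at hu ⊢
      rw [facesBelow_succ_tcons, map_sub, facesBelow_succ_tcons μ p, hu, map_zero, sub_zero,
        sub_eq_zero]
      refine LinearMap.congr_fun (f := facesBelow μ (p + 1) (k + 1) ∘ₗ act μ (k + 1) a)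
        (g := act μ k a ∘ₗ facesBelow μ (p + 1) (k + 1)) (tensorPower_hom_ext fun b w => ?_) u
      simp only [LinearMap.comp_apply, act_tcons, facesBelow_succ_tcons, map_sub]
      congr 1
      refine LinearMap.congr_fun (f := act μ k (μ a b))
        (g := act μ k a ∘ₗ act μ k b) (tensorPower_hom_ext fun c w => ?_) w
      simp only [LinearMap.comp_apply, act_tcons, hμ]

theorem facesAbove_facesAbove {μ : A →ₗ[K] A →ₗ[K] A} (hμ : ∀ x y z, μ (μ x y) z = μ x (μ y z))
    (p k : ℕ) : facesAbove μ p k ∘ₗ facesAbove μ p (k + 1) = 0 := by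
  induction k generalizing p with
  | zero => rw [facesAbove_zero_right, LinearMap.zero_comp]
  | succ k ih =>
    refine tensorPower_hom_ext fun a u => ?_
    cases p with
    | zero =>
      have hu := LinearMap.congr_fun (ih 0) u
      simp only [LinearMap.comp_apply, LinearMap.zero_apply] at hu ⊢
      rw [facesAbove_zero_tcons, map_sub, facesAbove_zero_tcons μ k a, hu, map_zero, sub_zero,
        sub_eq_zero]
      refine LinearMap.congr_fun (f := facesAbove μ 0 (k + 1) ∘ₗ act μ (k + 1) a)
        (g := act μ k a ∘ₗ facesAbove μ 0 (k + 1)) (tensorPower_hom_ext fun b w => ?_) u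
      simp only [LinearMap.comp_apply, act_tcons, facesAbove_zero_tcons, map_sub]
      congr 1
      refine LinearMap.congr_fun (f := act μ k (μ a b))
        (g := act μ k a ∘ₗ act μ k b) (tensorPower_hom_ext fun c w => ?_) w
      simp only [LinearMap.comp_apply, act_tcons, hμ]
    | succ p =>
      have hu := LinearMap.congr_fun (ih p) u
      simp only [LinearMap.comp_apply, LinearMap.zero_apply] at hu ⊢
      rw [facesAbove_succ_tcons, map_neg, facesAbove_succ_tcons, hu, map_zero, neg_zero, neg_zero]

/-- The two families of faces meet only around the factor `p`, where the mixed axiom `(x ≻ y) ≺ z =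
x ≻ (y ≺ z)` is used. Elsewhere they act on disjoint factors and the shift of index gives the sign.
The lower bound of `facesAbove` drops from `p + 1` to `p` because a horizontal face has removed one
factor on the left. -/
theorem facesBelow_facesAbove (D : DuplicialAlgebra K A) (p k : ℕ) :
    facesBelow D.right (p + 1) k ∘ₗ facesAbove D.left (p + 1) (k + 1) +
      facesAbove D.left p k ∘ₗ facesBelow D.right (p + 1) (k + 1) = 0 := by
  induction p generalizing k with
  | zero =>
    cases k with
    | zero => rw [facesBelow_zero_right, facesAbove_zero_right, LinearMap.zero_comp,
        LinearMap.zero_comp, add_zero]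
    | succ k =>
      refine tensorPower_hom_ext fun a u => ?_
      simp only [LinearMap.add_apply, LinearMap.comp_apply, LinearMap.zero_apply]
      rw [facesBelow_succ_tcons, facesBelow_zero, LinearMap.zero_apply, map_zero, sub_zero,
        facesAbove_succ_tcons, map_neg, facesBelow_succ_tcons, facesBelow_zero,
        LinearMap.zero_apply, map_zero, sub_zero, neg_add_eq_zero, eq_comm]
      refine LinearMap.congr_fun (f := facesAbove D.left 0 (k + 1) ∘ₗ act D.right (k + 1) a)
        (g := act D.right k a ∘ₗ facesAbove D.left 0 (k + 1))
        (tensorPower_hom_ext fun b w => ?_) u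
      simp only [LinearMap.comp_apply, act_tcons, facesAbove_zero_tcons, map_sub]
      congr 1
      refine LinearMap.congr_fun (f := act D.left k (D.right a b))
        (g := act D.right k a ∘ₗ act D.left k b) (tensorPower_hom_ext fun c w => ?_) w
      simp only [LinearMap.comp_apply, act_tcons, D.right_left]
  | succ p ih =>
    cases k with
    | zero => rw [facesBelow_zero_right, facesAbove_zero_right, LinearMap.zero_comp,
        LinearMap.zero_comp, add_zero]
    | succ k =>
      refine tensorPower_hom_ext fun a u => ?_
      have hu := LinearMap.congr_fun (ih k) u
      simp only [LinearMap.add_apply, LinearMap.comp_apply, LinearMap.zero_apply] at hu ⊢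
      have h1 : facesAbove D.left (p + 1) (k + 1) (act D.right (k + 1) a u) =
          act D.right k a (facesAbove D.left (p + 1) (k + 1) u) := by
        refine LinearMap.congr_fun
          (f := facesAbove D.left (p + 1) (k + 1) ∘ₗ act D.right (k + 1) a)
          (g := act D.right k a ∘ₗ facesAbove D.left (p + 1) (k + 1))
          (tensorPower_hom_ext fun b w => ?_) u
        simp only [LinearMap.comp_apply, act_tcons, facesAbove_succ_tcons, map_neg]
      rw [facesBelow_succ_tcons, facesAbove_succ_tcons, map_neg, map_sub, h1,
        facesBelow_succ_tcons, facesAbove_succ_tcons, eq_neg_of_add_eq_zero_left hu, map_neg]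
      abel

/-! ### The contracting homotopy -/

/-- The map `x ⊗ y, w ↦ x ⊗ y ⊗ w` on tensor powers. -/
def ins (k : ℕ) : A ⊗[K] A →ₗ[K] (⨂[K] _ : Fin k, A) →ₗ[K] ⨂[K] _ : Fin (k + 2), A :=
  TensorProduct.lift ((LinearMap.llcomp K _ _ _ ∘ₗ tcons (k + 1)).compl₂ (tcons k))

theorem ins_tmul (k : ℕ) (x y : A) (w : ⨂[K] _ : Fin k, A) :
    ins k (x ⊗ₜ[K] y) w = tcons (k + 1) x (tcons k y w) := by
  simp [ins]

theorem act_ins (μ : A →ₗ[K] A →ₗ[K] A) (k : ℕ) (a : A) (m : A ⊗[K] A) (w : ⨂[K] _ : Fin k, A) :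
    act μ (k + 1) a (ins k m w) = ins k (LinearMap.rTensor A (μ a) m) w := by
  induction m using TensorProduct.induction_on with
  | zero => simp
  | tmul x y => rw [LinearMap.rTensor_tmul, ins_tmul, ins_tmul, act_tcons]
  | add x y hx hy => simp only [map_add, LinearMap.add_apply, hx, hy]

theorem facesBelow_one_ins (μ : A →ₗ[K] A →ₗ[K] A) (k : ℕ) (m : A ⊗[K] A)
    (w : ⨂[K] _ : Fin k, A) :
    facesBelow μ 1 (k + 1) (ins k m w) = tcons k (TensorProduct.lift μ m) w := by
  induction m using TensorProduct.induction_on with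
  | zero => simp
  | tmul x y =>
    rw [ins_tmul, facesBelow_succ_tcons, facesBelow_zero, LinearMap.zero_apply, map_zero,
      sub_zero, act_tcons, TensorProduct.lift.tmul]
  | add x y hx hy => simp only [map_add, LinearMap.add_apply, hx, hy]

/-- The face `1` multiplies the second leg of `m` by `b`. The remaining faces do not touch `m` and
keep their signs, since their index is shifted by two. -/
theorem facesAbove_one_ins (μ : A →ₗ[K] A →ₗ[K] A) (k : ℕ) (m : A ⊗[K] A) (b : A)
    (w : ⨂[K] _ : Fin k, A) :
    facesAbove μ 1 (k + 2) (ins (k + 1) m (tcons k b w)) =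
      ins k m (facesAbove μ 0 k (tcons k b w)) - ins k (LinearMap.lTensor A (μ.flip b) m) w := by
  induction m using TensorProduct.induction_on with
  | zero => simp
  | tmul x y =>
    rw [ins_tmul, facesAbove_succ_tcons, facesAbove_zero_tcons, act_tcons, map_sub, neg_sub,
      LinearMap.lTensor_tmul, ins_tmul, ins_tmul, LinearMap.flip_apply]
  | add x y hx hy =>
    simp only [map_add, LinearMap.add_apply, hx, hy]
    abel

theorem facesAbove_zero_ins (μ : A →ₗ[K] A →ₗ[K] A) (k : ℕ) (m : A ⊗[K] A)
    (w : ⨂[K] _ : Fin k, A) :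
    facesAbove μ 0 (k + 1) (ins k m w) =
      tcons k (TensorProduct.lift μ m) w + facesAbove μ 1 (k + 1) (ins k m w) := by
  induction m using TensorProduct.induction_on with
  | zero => simp
  | tmul x y =>
    rw [ins_tmul, facesAbove_succ_tcons, facesAbove_zero_tcons, act_tcons,
      TensorProduct.lift.tmul, sub_eq_add_neg]
  | add x y hx hy =>
    simp only [map_add, LinearMap.add_apply, hx, hy]
    abel

/-- The data which contract the operadic chain complex of a duplicial algebra: `resRight` and
`resLeft` split off the last factor of the products `x ≻ y` and, modulo the image of `≻`, of
the products `x ≺ y`. -/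
structure Contraction (D : DuplicialAlgebra K A) (ι : N →ₗ[K] A) (π : A →ₗ[K] N) where
  resRight : A →ₗ[K] A ⊗[K] A
  resLeft : A →ₗ[K] A ⊗[K] A
  decomp : ∀ x, TensorProduct.lift D.right (resRight x) + TensorProduct.lift D.left (resLeft x) +
    ι (π x) = x
  resRight_right : ∀ x y, resRight (D.right x y) = LinearMap.rTensor A (D.right x) (resRight y) +
    x ⊗ₜ[K] (y - TensorProduct.lift D.right (resRight y))
  resRight_left : ∀ x y, resRight (D.left x y) = LinearMap.lTensor A (D.left.flip y) (resRight x)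
  resLeft_right : ∀ x y, resLeft (D.right x y) = 0
  resLeft_left : ∀ x y, resLeft (D.left x y) =
    LinearMap.lTensor A (D.left.flip y) (resLeft x) + ι (π x) ⊗ₜ[K] y
  proj_right : ∀ x y, π (D.right x y) = 0
  proj_left : ∀ x y, π (D.left x y) = 0

/-- The map which applies `σ` to the first factor. -/
def insFirst (σ : A →ₗ[K] A ⊗[K] A) (k : ℕ) :
    (⨂[K] _ : Fin (k + 1), A) →ₗ[K] ⨂[K] _ : Fin (k + 2), A :=
  tuncons k (ins k ∘ₗ σ)

theorem insFirst_tcons (σ : A →ₗ[K] A ⊗[K] A) (k : ℕ) (a : A) (w : ⨂[K] _ : Fin k, A) :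
    insFirst σ k (tcons k a w) = ins k (σ a) w := by
  rw [insFirst, tuncons_tcons, LinearMap.comp_apply]

/-- The map which applies `σ` to the factor with index `p`, with the sign `(-1) ^ p`. -/
def insAt (σ : A →ₗ[K] A ⊗[K] A) : ∀ _ k : ℕ,
    (⨂[K] _ : Fin (k + 1), A) →ₗ[K] ⨂[K] _ : Fin (k + 2), A
  | 0, k => insFirst σ k
  | _ + 1, 0 => 0
  | p + 1, k + 1 => -tuncons (k + 1) ((tcons (k + 2)).compl₂ (insAt σ p k))

theorem insAt_zero (σ : A →ₗ[K] A ⊗[K] A) (k : ℕ) : insAt σ 0 k = insFirst σ k := by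
  rw [insAt]

theorem insAt_succ_tcons (σ : A →ₗ[K] A ⊗[K] A) (p k : ℕ) (a : A) (u : ⨂[K] _ : Fin (k + 1), A) :
    insAt σ (p + 1) (k + 1) (tcons (k + 1) a u) = -tcons (k + 2) a (insAt σ p k u) := by
  rw [insAt, LinearMap.neg_apply, tuncons_tcons, LinearMap.compl₂_apply]

variable {D : DuplicialAlgebra K A} {ι : N →ₗ[K] A} {π : A →ₗ[K] N}

/-- The rows are contracted in positive horizontal degree. For `p = 0` this is the rule
`resRight_right`: on `a ⊗ b` the terms `a ≻ σ b` cancel, and `a ⊗ μ (σ b)` is completed to `a ⊗ b`,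
where `σ` is `resRight` and `μ` is the linearized `≻`. -/
theorem facesBelow_insAt (c : Contraction D ι π) (p k : ℕ) (hp : p ≤ k)
    (u : ⨂[K] _ : Fin (k + 2), A) :
    facesBelow D.right (p + 2) (k + 2) (insAt c.resRight (p + 1) (k + 1) u) +
      insAt c.resRight p k (facesBelow D.right (p + 1) (k + 1) u) = u := by
  induction p generalizing k with
  | zero =>
    induction u using tensorPower_induction with
    | hadd x y hx hy =>
      simp only [map_add]
      rw [add_add_add_comm, hx, hy]
    | hcons a u =>
      induction u using tensorPower_induction with
      | hadd x y hx hy =>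
        simp only [map_add]
        rw [add_add_add_comm, hx, hy]
      | hcons b w =>
        rw [insAt_succ_tcons, insAt_zero, insFirst_tcons, map_neg, facesBelow_succ_tcons, act_ins,
          facesBelow_one_ins, facesBelow_succ_tcons, act_tcons, facesBelow_zero,
          LinearMap.zero_apply, map_zero, sub_zero, insFirst_tcons, c.resRight_right, map_add,
          LinearMap.add_apply, ins_tmul, map_sub, LinearMap.sub_apply, map_sub]
        abel
  | succ p ih =>
    obtain ⟨k, rfl⟩ : ∃ k', k = k' + 1 := ⟨k - 1, by omega⟩
    induction u using tensorPower_induction with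
    | hadd x y hx hy =>
      simp only [map_add]
      rw [add_add_add_comm, hx, hy]
    | hcons a u =>
      -- The insertion takes place strictly after the first factor, so it commutes with the action
      -- of `a` on that factor.
      have h1 : insAt c.resRight (p + 1) (k + 1) (act D.right (k + 1) a u) =
          act D.right (k + 2) a (insAt c.resRight (p + 1) (k + 1) u) := by
        refine LinearMap.congr_fun
          (f := insAt c.resRight (p + 1) (k + 1) ∘ₗ act D.right (k + 1) a)
          (g := act D.right (k + 2) a ∘ₗ insAt c.resRight (p + 1) (k + 1))
          (tensorPower_hom_ext fun b w => ?_) u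
        simp only [LinearMap.comp_apply, act_tcons, insAt_succ_tcons, map_neg]
      conv_rhs => rw [← ih k (by omega) u]
      rw [insAt_succ_tcons, map_neg, facesBelow_succ_tcons, facesBelow_succ_tcons, map_sub, h1,
        insAt_succ_tcons, map_add]
      abel

/-- The row homotopy anticommutes with the vertical differential. At the factor `p` this is
`resRight_left`, that is, `σ (a ≺ b) = σ a ≺ b`. -/
theorem facesAbove_insAt (c : Contraction D ι π) (p k : ℕ) (hp : p ≤ k)
    (u : ⨂[K] _ : Fin (k + 2), A) :
    facesAbove D.left (p + 1) (k + 2) (insAt c.resRight p (k + 1) u) +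
      insAt c.resRight p k (facesAbove D.left p (k + 1) u) = 0 := by
  induction p generalizing k with
  | zero =>
    induction u using tensorPower_induction with
    | hadd x y hx hy =>
      simp only [map_add]
      rw [add_add_add_comm, hx, hy, add_zero]
    | hcons a u =>
      induction u using tensorPower_induction with
      | hadd x y hx hy =>
        simp only [map_add]
        rw [add_add_add_comm, hx, hy, add_zero]
      | hcons b w =>
        rw [insAt_zero, insAt_zero, insFirst_tcons, facesAbove_one_ins, facesAbove_zero_tcons,
          act_tcons, map_sub, insFirst_tcons, insFirst_tcons, c.resRight_left]
        abel
  | succ p ih =>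
    obtain ⟨k, rfl⟩ : ∃ k', k = k' + 1 := ⟨k - 1, by omega⟩
    induction u using tensorPower_induction with
    | hadd x y hx hy =>
      simp only [map_add]
      rw [add_add_add_comm, hx, hy, add_zero]
    | hcons a u =>
      rw [insAt_succ_tcons, map_neg, facesAbove_succ_tcons, facesAbove_succ_tcons, map_neg,
        insAt_succ_tcons, neg_neg, neg_neg, ← map_add, ih k (by omega), map_zero]

/-- The column homotopy vanishes on what arrives from column one, since `resLeft` kills the products
by `≻`. -/
theorem insFirst_facesBelow_one (c : Contraction D ι π) (k : ℕ) (u : ⨂[K] _ : Fin (k + 2), A) :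
    insFirst c.resLeft k (facesBelow D.right 1 (k + 1) u) = 0 := by
  induction u using tensorPower_induction with
  | hadd x y hx hy => rw [map_add, map_add, hx, hy, add_zero]
  | hcons a u =>
    induction u using tensorPower_induction with
    | hadd x y hx hy => rw [map_add, map_add, map_add, hx, hy, add_zero]
    | hcons b w =>
      rw [facesBelow_succ_tcons, facesBelow_zero, LinearMap.zero_apply, map_zero, sub_zero,
        act_tcons, insFirst_tcons, c.resLeft_right, map_zero, LinearMap.zero_apply]

/-- In column zero the row homotopy recovers the part `μ (σ a)` of the first factor, and the column
homotopy recovers the rest: `decomp` splits `a` into three terms, and the last one, `ι (π a) ⊗ b`,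
is exactly the correction in `resLeft_left`. -/
theorem facesAbove_insFirst (c : Contraction D ι π) (k : ℕ) (u : ⨂[K] _ : Fin (k + 2), A) :
    facesBelow D.right 1 (k + 2) (insFirst c.resRight (k + 1) u) +
      (facesAbove D.left 0 (k + 2) (insFirst c.resLeft (k + 1) u) +
        insFirst c.resLeft k (facesAbove D.left 0 (k + 1) u)) = u := by
  induction u using tensorPower_induction with
  | hadd x y hx hy =>
    conv_rhs => rw [← hx, ← hy]
    simp only [map_add]
    abel
  | hcons a u =>
    induction u using tensorPower_induction with
    | hadd x y hx hy =>
      conv_rhs => rw [map_add, ← hx, ← hy]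
      simp only [map_add]
      abel
    | hcons b w =>
      conv_rhs => rw [← c.decomp a]
      rw [insFirst_tcons, insFirst_tcons, facesBelow_one_ins, facesAbove_zero_ins,
        facesAbove_one_ins, facesAbove_zero_tcons, act_tcons, map_sub, insFirst_tcons,
        insFirst_tcons, c.resLeft_left, map_add, LinearMap.add_apply, ins_tmul, map_add, map_add,
        LinearMap.add_apply, LinearMap.add_apply]
      abel

/-- With a single factor there is no `b` to produce the term `ι (π a) ⊗ b`, so the defect of the
homotopy in degree zero is `ι π`. -/
theorem facesBelow_add_facesAbove_insFirst_zero (c : Contraction D ι π) (a : A)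
    (w : ⨂[K] _ : Fin 0, A) :
    facesBelow D.right 1 1 (insFirst c.resRight 0 (tcons 0 a w)) +
      facesAbove D.left 0 1 (insFirst c.resLeft 0 (tcons 0 a w)) + tcons 0 (ι (π a)) w =
      tcons 0 a w := by
  conv_rhs => rw [← c.decomp a]
  have h : facesAbove D.left 1 1 = 0 := by simp [facesAbove]
  rw [insFirst_tcons, insFirst_tcons, facesBelow_one_ins, facesAbove_zero_ins, h,
    LinearMap.zero_apply, add_zero, map_add, map_add, LinearMap.add_apply, LinearMap.add_apply]

/-! ### The total complex -/

variable (D) in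
/-- The differential of the total complex. -/
def totDiff (n : ℕ) : (Fin (n + 2) → ⨂[K] _ : Fin (n + 2), A) →ₗ[K]
    (Fin (n + 1) → ⨂[K] _ : Fin (n + 1), A) :=
  LinearMap.pi fun p => facesBelow D.right (p + 1) (n + 1) ∘ₗ LinearMap.proj p.succ +
    facesAbove D.left p (n + 1) ∘ₗ LinearMap.proj p.castSucc

theorem totDiff_apply (n : ℕ) (x : Fin (n + 2) → ⨂[K] _ : Fin (n + 2), A) (p : Fin (n + 1)) :
    totDiff D n x p = facesBelow D.right (p + 1) (n + 1) (x p.succ) +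
      facesAbove D.left p (n + 1) (x p.castSucc) := rfl

/-- The component `p` receives contributions from three components of `x`, namely `p + 2`, `p + 1`
and `p`. They vanish by the horizontal, mixed and vertical relations, respectively. -/
theorem totDiff_totDiff (n : ℕ) (x : Fin (n + 3) → ⨂[K] _ : Fin (n + 3), A) :
    totDiff D n (totDiff D (n + 1) x) = 0 := by
  funext p
  have h1 := LinearMap.congr_fun (facesBelow_facesBelow D.right_right (p + 1) (n + 1))
    (x p.succ.succ)
  have h2 := LinearMap.congr_fun (facesAbove_facesAbove D.left_left p (n + 1))
    (x p.castSucc.castSucc)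
  have h3 := LinearMap.congr_fun (facesBelow_facesAbove D p (n + 1)) (x p.castSucc.succ)
  simp only [LinearMap.comp_apply, LinearMap.add_apply, LinearMap.zero_apply] at h1 h2 h3
  rw [totDiff_apply, totDiff_apply, totDiff_apply, Fin.succ_castSucc, map_add, map_add,
    Fin.val_succ, Fin.val_castSucc, h1, h2, zero_add, add_zero]
  rw [Fin.succ_castSucc] at h3
  exact h3

/-- The contracting homotopy of the total complex. -/
def Contraction.homotopy (c : Contraction D ι π) (n : ℕ)
    (x : Fin (n + 1) → ⨂[K] _ : Fin (n + 1), A) : Fin (n + 2) → ⨂[K] _ : Fin (n + 2), A :=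
  Fin.cons (insFirst c.resLeft n (x 0)) fun p => insAt c.resRight p n (x p)

theorem Contraction.homotopy_zero (c : Contraction D ι π) (n : ℕ) : c.homotopy n 0 = 0 := by
  funext p
  refine Fin.cases ?_ (fun p => ?_) p <;> simp [Contraction.homotopy]

/-- In the components of positive index the row identity gives `x` and the anticommutation removes
the cross terms. The component zero is the column identity. -/
theorem Contraction.totDiff_homotopy (c : Contraction D ι π) (n : ℕ)
    (x : Fin (n + 2) → ⨂[K] _ : Fin (n + 2), A) :
    totDiff D (n + 1) (c.homotopy (n + 1) x) + c.homotopy n (totDiff D n x) = x := by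
  funext p
  rw [Pi.add_apply, totDiff_apply]
  refine Fin.cases ?_ (fun p => ?_) p
  · have h := facesAbove_insFirst c n (x 0)
    simp only [Contraction.homotopy, Fin.cons_succ, Fin.cons_zero, Fin.castSucc_zero, totDiff_apply,
      Fin.val_zero, insAt_zero, map_add, zero_add, insFirst_facesBelow_one]
    exact (add_assoc _ _ _).trans h
  · have h1 := facesBelow_insAt c p n (by omega) (x p.succ)
    have h2 := facesAbove_insAt c p n (by omega) (x p.castSucc)
    simp only [Contraction.homotopy, Fin.cons_succ, ← Fin.succ_castSucc, totDiff_apply,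
      Fin.val_succ, Fin.val_castSucc, map_add]
    rw [add_add_add_comm]
    exact (congrArg₂ (· + ·) h1 h2).trans (add_zero _)

theorem exact_totDiff (c : Contraction D ι π) (n : ℕ) :
    Function.Exact (totDiff D (n + 1)) (totDiff D n) := by
  intro x
  constructor
  · intro hx
    have h := c.totDiff_homotopy n x
    rw [hx, c.homotopy_zero, add_zero] at h
    exact ⟨_, h⟩
  · rintro ⟨y, rfl⟩
    exact totDiff_totDiff n y

/-- The homotopy provides a preimage when `ι π` vanishes. Conversely `π` kills both kinds of
products, hence every boundary. -/
theorem exact_totDiff_zero (c : Contraction D ι π) :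
    Function.Exact (totDiff D 0) fun x : Fin 1 → ⨂[K] _ : Fin 1, A =>
      π (PiTensorProduct.subsingletonEquiv (0 : Fin 1) (x 0)) := by
  have hs (a : A) : PiTensorProduct.subsingletonEquiv (0 : Fin 1)
      (tcons 0 a (PiTensorProduct.tprod K Fin.elim0)) = a := by
    rw [tcons_tprod, PiTensorProduct.subsingletonEquiv_apply_tprod]
    rfl
  have hx (x : ⨂[K] _ : Fin 1, A) : x = tcons 0 (PiTensorProduct.subsingletonEquiv (0 : Fin 1) x)
      (PiTensorProduct.tprod K Fin.elim0) :=
    (PiTensorProduct.subsingletonEquiv (R := K) (s := fun _ : Fin 1 => A) 0).injective (hs _).symm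
  intro x
  constructor
  · intro h
    refine ⟨c.homotopy 0 x, ?_⟩
    funext p
    obtain rfl : p = 0 := Fin.fin_one_eq_zero p
    replace h : π (PiTensorProduct.subsingletonEquiv (0 : Fin 1) (x 0)) = 0 := h
    have h2 := facesBelow_add_facesAbove_insFirst_zero c
      (PiTensorProduct.subsingletonEquiv (0 : Fin 1) (x 0)) (PiTensorProduct.tprod K Fin.elim0)
    rw [h, map_zero, map_zero, LinearMap.zero_apply, add_zero, ← hx] at h2
    rw [totDiff_apply]
    exact h2
  · rintro ⟨y, rfl⟩
    have hr : ∀ u : ⨂[K] _ : Fin 2, A, π (PiTensorProduct.subsingletonEquiv (0 : Fin 1)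
        (facesBelow D.right 1 1 u)) = 0 := by
      intro u
      induction u using tensorPower_induction with
      | hadd x y hx hy => rw [map_add, map_add, map_add, hx, hy, add_zero]
      | hcons a u =>
        rw [hx u, facesBelow_succ_tcons, facesBelow_zero, LinearMap.zero_apply, map_zero, sub_zero,
          act_tcons, hs, c.proj_right]
    have hl : ∀ u : ⨂[K] _ : Fin 2, A, π (PiTensorProduct.subsingletonEquiv (0 : Fin 1)
        (facesAbove D.left 0 1 u)) = 0 := by
      intro u
      induction u using tensorPower_induction with
      | hadd x y hx hy => rw [map_add, map_add, map_add, hx, hy, add_zero]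
      | hcons a u =>
        rw [hx u, facesAbove_zero_tcons, facesAbove_zero_right, LinearMap.zero_apply, map_zero,
          sub_zero, act_tcons, hs, c.proj_left]
    change π (PiTensorProduct.subsingletonEquiv (0 : Fin 1)
      (facesBelow D.right 1 1 (y 1) + facesAbove D.left 0 1 (y 0))) = 0
    rw [map_add, map_add, hr, hl, add_zero]

end TensorPowers

/-! ### Contractions of free duplicial algebras -/

section FreeAlgebras

/-! ### Duplicial structures on `A × (A ⊗ A)` -/

section Extensions

variable {K : Type u} [Field K] {A : Type w} [AddCommGroup A] [Module K A]
  (D : DuplicialAlgebra K A)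

theorem lift_right_rTensor (x : A) (t : A ⊗[K] A) :
    TensorProduct.lift D.right (LinearMap.rTensor A (D.right x) t) =
      D.right x (TensorProduct.lift D.right t) := by
  induction t using TensorProduct.induction_on with
  | zero => simp
  | tmul a b => simp [D.right_right]
  | add a b ha hb => simp only [map_add, ha, hb]

theorem lift_right_lTensor (y : A) (t : A ⊗[K] A) :
    TensorProduct.lift D.right (LinearMap.lTensor A (D.left.flip y) t) =
      D.left (TensorProduct.lift D.right t) y := by
  induction t using TensorProduct.induction_on with
  | zero => simp
  | tmul a b => simp [D.right_left]
  | add a b ha hb => simp only [map_add, ha, hb, LinearMap.add_apply]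

theorem lift_left_lTensor (y : A) (t : A ⊗[K] A) :
    TensorProduct.lift D.left (LinearMap.lTensor A (D.left.flip y) t) =
      D.left (TensorProduct.lift D.left t) y := by
  induction t using TensorProduct.induction_on with
  | zero => simp
  | tmul a b => simp [D.left_left]
  | add a b ha hb => simp only [map_add, ha, hb, LinearMap.add_apply]

theorem lTensor_lTensor_left (y z : A) (t : A ⊗[K] A) :
    LinearMap.lTensor A (D.left.flip z) (LinearMap.lTensor A (D.left.flip y) t) =
      LinearMap.lTensor A (D.left.flip (D.left y z)) t := by
  induction t using TensorProduct.induction_on with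
  | zero => simp
  | tmul a b => simp [D.left_left]
  | add a b ha hb => simp only [map_add, ha, hb]

theorem rTensor_rTensor_right (x y : A) (t : A ⊗[K] A) :
    LinearMap.rTensor A (D.right x) (LinearMap.rTensor A (D.right y) t) =
      LinearMap.rTensor A (D.right (D.right x y)) t := by
  induction t using TensorProduct.induction_on with
  | zero => simp
  | tmul a b => simp [D.right_right]
  | add a b ha hb => simp only [map_add, ha, hb]

theorem lTensor_rTensor (x z : A) (t : A ⊗[K] A) :
    LinearMap.lTensor A (D.left.flip z) (LinearMap.rTensor A (D.right x) t) =
      LinearMap.rTensor A (D.right x) (LinearMap.lTensor A (D.left.flip z) t) := by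
  induction t using TensorProduct.induction_on with
  | zero => simp
  | tmul a b => simp
  | add a b ha hb => simp only [map_add, ha, hb]

/-- The duplicial algebra `A × (A ⊗ A)` whose sections over `A` are the maps `σ` such that
`σ (x ≻ y) = x ≻ σ y + x ⊗ (y - μ (σ y))` and `σ (x ≺ y) = σ x ≺ y`. -/
def rightExtension : DuplicialAlgebra K (A × A ⊗[K] A) where
  left := LinearMap.mk₂ K
    (fun s t => (D.left s.1 t.1, LinearMap.lTensor A (D.left.flip t.1) s.2))
    (fun s s' t => by simp)
    (fun c s t => by simp)
    (fun s t t' => by simp [LinearMap.lTensor_add])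
    (fun c s t => by simp [LinearMap.lTensor_smul])
  right := LinearMap.mk₂ K
    (fun s t => (D.right s.1 t.1, LinearMap.rTensor A (D.right s.1) t.2 +
      s.1 ⊗ₜ[K] (t.1 - TensorProduct.lift D.right t.2)))
    (fun s s' t => by
      ext
      · simp
      · simp only [Prod.fst_add, map_add, LinearMap.rTensor_add, TensorProduct.add_tmul,
          LinearMap.add_apply, Prod.snd_add]
        abel)
    (fun c s t => by
      simp [LinearMap.rTensor_smul, TensorProduct.smul_tmul'])
    (fun s t t' => by
      ext
      · simp
      · simp only [Prod.fst_add, Prod.snd_add, map_add, add_sub_add_comm, TensorProduct.tmul_add]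
        abel)
    (fun c s t => by
      simp [← smul_sub])
  left_left x y z := by
    ext
    · simp [D.left_left]
    · simp [lTensor_lTensor_left]
  right_left x y z := by
    ext
    · simp [D.right_left]
    · simp [lTensor_rTensor, lift_right_lTensor]
  right_right x y z := by
    ext
    · simp [D.right_right]
    -- For `y ≻ z` with second component `t'`, one has `μ t' = y ≻ z` on first components, where `μ`
    -- is the linearized `≻`. The outer correction term of `x ≻ (y ≻ z)` is therefore zero.
    · simp [rTensor_rTensor_right, lift_right_rTensor]

/-- The duplicial algebra `A × (A ⊗ A)` whose sections over `A` are the maps `θ` such that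
`θ (x ≻ y) = 0` and `θ (x ≺ y) = θ x ≺ y + (ρ x - μ (θ x)) ⊗ y`. -/
def leftExtension (ρ : A →ₗ[K] A) (hr : ∀ x y, ρ (D.right x y) = 0)
    (hl : ∀ x y, ρ (D.left x y) = D.left (ρ x) y) : DuplicialAlgebra K (A × A ⊗[K] A) where
  left := LinearMap.mk₂ K
    (fun s t => (D.left s.1 t.1, LinearMap.lTensor A (D.left.flip t.1) s.2 +
      (ρ s.1 - TensorProduct.lift D.left s.2) ⊗ₜ[K] t.1))
    (fun s s' t => by
      ext
      · simp
      · simp only [Prod.fst_add, Prod.snd_add, map_add, add_sub_add_comm, TensorProduct.add_tmul]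
        abel)
    (fun c s t => by
      simp [← smul_sub, TensorProduct.smul_tmul'])
    (fun s t t' => by
      ext
      · simp
      · simp only [Prod.fst_add, map_add, LinearMap.lTensor_add, TensorProduct.tmul_add,
          LinearMap.add_apply, Prod.snd_add]
        abel)
    (fun c s t => by
      simp [LinearMap.lTensor_smul])
  right := LinearMap.mk₂ K (fun s t => (D.right s.1 t.1, 0))
    (fun s s' t => by simp) (fun c s t => by simp) (fun s t t' => by simp) (fun c s t => by simp)
  left_left x y z := by
    ext
    · simp [D.left_left]
    -- The linearized `≺` sends the second component of `x ≺ y` to `ρ x ≺ y`, which is `ρ (x ≺ y)`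
    -- by `hl`. The correction term of `(x ≺ y) ≺ z` is therefore zero.
    · simp [lTensor_lTensor_left, lift_left_lTensor, hl]
  right_left x y z := by
    ext
    · simp [D.right_left]
    · simp [hr]
  right_right x y z := by
    ext
    · simp [D.right_right]
    · simp

variable (K A) in
/-- The duplicial algebra with zero operations. -/
def zeroDuplicial : DuplicialAlgebra K A where
  left := 0
  right := 0
  left_left _ _ _ := rfl
  right_left _ _ _ := rfl
  right_right _ _ _ := rfl

end Extensions

/-! ### What freeness provides -/

variable {K : Type u} [Field K] {V : Type v} [AddCommGroup V] [Module K V]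
  {A : Type (max u v)} [AddCommGroup A] [Module K A] {D : DuplicialAlgebra K A} {ι : V →ₗ[K] A}

theorem IsFreeDuplicial.hom_ext (hD : IsFreeDuplicial D ι) {B : Type (max u v)} [AddCommGroup B]
    [Module K B] (D' : DuplicialAlgebra K B) {f g : A →ₗ[K] B} (hf : IsDuplicialHom D D' f)
    (hg : IsDuplicialHom D D' g) (h : f ∘ₗ ι = g ∘ₗ ι) : f = g :=
  (hD B D' (g ∘ₗ ι)).unique ⟨hf, h⟩ ⟨hg, rfl⟩

/-- Freeness extends `v ↦ (ι v, 0)` to a morphism. Its first coordinate is an endomorphism of `A`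
fixing the generators, hence the identity, so its second coordinate is a map defined by recursion on
products. -/
theorem IsFreeDuplicial.exists_section (hD : IsFreeDuplicial D ι)
    (D' : DuplicialAlgebra K (A × A ⊗[K] A))
    (hl : ∀ x y, (D'.left x y).1 = D.left x.1 y.1)
    (hr : ∀ x y, (D'.right x y).1 = D.right x.1 y.1) :
    ∃ σ : A →ₗ[K] A ⊗[K] A, (∀ v, σ (ι v) = 0) ∧
      (∀ x y, σ (D.left x y) = (D'.left (x, σ x) (y, σ y)).2) ∧
      ∀ x y, σ (D.right x y) = (D'.right (x, σ x) (y, σ y)).2 := by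
  obtain ⟨g, ⟨⟨hgl, hgr⟩, hg⟩, -⟩ := hD _ D' (LinearMap.prod ι 0)
  have h1 : LinearMap.fst K A (A ⊗[K] A) ∘ₗ g = LinearMap.id := by
    refine hD.hom_ext D ⟨fun x y => ?_, fun x y => ?_⟩ ⟨fun _ _ => rfl, fun _ _ => rfl⟩ ?_
    · simp [hgl, hl]
    · simp [hgr, hr]
    · rw [LinearMap.comp_assoc, hg]
      ext v
      simp
  have h2 : ∀ x, g x = (x, (g x).2) := fun x => Prod.ext (LinearMap.congr_fun h1 x) rfl
  refine ⟨LinearMap.snd K A (A ⊗[K] A) ∘ₗ g, fun v => ?_, fun x y => ?_, fun x y => ?_⟩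
  · have := LinearMap.congr_fun hg v
    simp only [LinearMap.comp_apply] at this
    simp [this]
  · simp only [LinearMap.comp_apply, LinearMap.snd_apply, ← h2, hgl]
  · simp only [LinearMap.comp_apply, LinearMap.snd_apply, ← h2, hgr]

/-- A morphism to an algebra with zero operations is a linear map that kills all products. -/
theorem IsFreeDuplicial.exists_proj (hD : IsFreeDuplicial D ι) :
    ∃ π : A →ₗ[K] V, π ∘ₗ ι = LinearMap.id ∧ (∀ x y, π (D.right x y) = 0) ∧
      ∀ x y, π (D.left x y) = 0 := by
  -- The universal property is stated in the universe of `A`, so `V` has to be lifted to it.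
  obtain ⟨g, ⟨⟨hgl, hgr⟩, hg⟩, -⟩ := hD (ULift.{u} V) (zeroDuplicial K (ULift.{u} V))
    (ULift.moduleEquiv (R := K) (M := V)).symm.toLinearMap
  refine ⟨(ULift.moduleEquiv (R := K) (M := V)).toLinearMap ∘ₗ g, ?_, fun x y => ?_, fun x y => ?_⟩
  · rw [LinearMap.comp_assoc, hg]
    ext v
    simp
  · rw [LinearMap.comp_apply, hgr]
    rfl
  · rw [LinearMap.comp_apply, hgl]
    rfl

/-- The rules for `σ` and `θ` are imposed by the two extensions, and `decomp` follows by uniqueness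
of morphisms. The projection is a parameter so that the Koszul complex can use the projection onto
arity one. -/
theorem IsFreeDuplicial.nonempty_contraction (hD : IsFreeDuplicial D ι) {π : A →ₗ[K] V}
    (hπ : π ∘ₗ ι = LinearMap.id) (hπr : ∀ x y, π (D.right x y) = 0)
    (hπl : ∀ x y, π (D.left x y) = 0) : Nonempty (Contraction D ι π) := by
  obtain ⟨σ, hσι, hσl, hσr⟩ := hD.exists_section (rightExtension D) (fun _ _ => rfl)
    (fun _ _ => rfl)
  replace hσl : ∀ x y, σ (D.left x y) = LinearMap.lTensor A (D.left.flip y) (σ x) := hσl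
  replace hσr : ∀ x y, σ (D.right x y) = LinearMap.rTensor A (D.right x) (σ y) +
    x ⊗ₜ[K] (y - TensorProduct.lift D.right (σ y)) := hσr
  -- `ρ` removes the part of `x` recovered by `≻`. It kills the products by `≻` and commutes with
  -- right multiplication by `≺`, as required by `leftExtension`.
  obtain ⟨ρ, hρ⟩ : ∃ ρ : A →ₗ[K] A, ∀ x, ρ x = x - TensorProduct.lift D.right (σ x) :=
    ⟨LinearMap.id - TensorProduct.lift D.right ∘ₗ σ, fun _ => rfl⟩
  have hρr : ∀ x y, ρ (D.right x y) = 0 := fun x y => by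
    rw [hρ, hσr, map_add, lift_right_rTensor, TensorProduct.lift.tmul, ← map_add,
      add_sub_cancel, sub_self]
  have hρl : ∀ x y, ρ (D.left x y) = D.left (ρ x) y := fun x y => by
    rw [hρ, hσl, lift_right_lTensor, hρ, map_sub, LinearMap.sub_apply]
  obtain ⟨θ, hθι, hθl, hθr⟩ := hD.exists_section (leftExtension D ρ hρr hρl) (fun _ _ => rfl)
    (fun _ _ => rfl)
  replace hθl : ∀ x y, θ (D.left x y) = LinearMap.lTensor A (D.left.flip y) (θ x) +
    (ρ x - TensorProduct.lift D.left (θ x)) ⊗ₜ[K] y := hθl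
  replace hθr : ∀ x y, θ (D.right x y) = 0 := hθr
  -- Both sides kill all products and agree with `ι` on the generators, so they are the same
  -- morphism to the algebra `A` with zero operations.
  have hψ : ρ - TensorProduct.lift D.left ∘ₗ θ = ι ∘ₗ π := by
    refine hD.hom_ext (zeroDuplicial K A) ⟨fun x y => ?_, fun x y => ?_⟩
      ⟨fun x y => ?_, fun x y => ?_⟩ ?_
    · change ρ (D.left x y) - TensorProduct.lift D.left (θ (D.left x y)) = 0
      rw [hρl, hθl, map_add, lift_left_lTensor, TensorProduct.lift.tmul, map_sub,
        LinearMap.sub_apply]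
      abel
    · change ρ (D.right x y) - TensorProduct.lift D.left (θ (D.right x y)) = 0
      rw [hρr, hθr, map_zero, sub_zero]
    · rw [LinearMap.comp_apply, hπl, map_zero]
      rfl
    · rw [LinearMap.comp_apply, hπr, map_zero]
      rfl
    · rw [LinearMap.comp_assoc, hπ]
      ext v
      simp [hρ, hσι, hθι]
  have hψ' : ∀ x, ρ x - TensorProduct.lift D.left (θ x) = ι (π x) := LinearMap.congr_fun hψ
  exact ⟨{
    resRight := σ
    resLeft := θ
    decomp := fun x => by
      rw [← hψ', hρ]
      abel
    resRight_right := hσr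
    resRight_left := hσl
    resLeft_right := hθr
    resLeft_left := fun x y => by rw [hθl, hψ']
    proj_right := hπr
    proj_left := hπl }⟩

end FreeAlgebras

/-! ### The operadic chain complex and the total complex -/

section Comparison

variable {K : Type u} [Field K] {A : Type w} [AddCommGroup A] [Module K A]

variable (A) in
/-- The map `f ⊗ a ↦ f(x ≻ ⋯ ≻ x ≺ ⋯ ≺ x) a`. -/
def evalMon (p q : ℕ) {n : ℕ} (h : p + q + 1 = n) :
    Chains (dupRelators K) A n →ₗ[K] ⨂[K] _ : Fin n, A :=
  (TensorProduct.lid K _).toLinearMap ∘ₗ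
    LinearMap.rTensor _ (Module.Dual.eval K _ (monOp K p q h))

theorem evalMon_tmul (p q : ℕ) {n : ℕ} (h : p + q + 1 = n)
    (f : Module.Dual K ((koszulDual (dupRelators K)).Op n)) (a : ⨂[K] _ : Fin n, A) :
    evalMon A p q h (f ⊗ₜ[K] a) = f (monOp K p q h) • a := by
  simp [evalMon]

theorem sum_dupGen {M : Type w} [AddCommMonoid M] (f : DupGen → M) :
    ∑ e, f e = f .left + f .right := by
  rw [show (Finset.univ : Finset DupGen) = {DupGen.left, DupGen.right} from rfl,
    Finset.sum_pair (by decide)]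

/-- The differential is the transpose of the insertion of generators. Evaluated at the monomial `(p,
q)`, it involves only the monomials `(p + 1, q)`, through `≻` at `i ≤ p`, and `(p, q + 1)`, through
`≺` at `i ≥ p`. -/
theorem evalMon_differential (D : DuplicialAlgebra K A) (p q : ℕ) {n : ℕ} (h : p + q + 1 = n)
    (x : Chains (dupRelators K) A (n + 1)) :
    evalMon A p q h (differential (dupRelators K) D.op n x) =
      facesBelow D.right (p + 1) n (evalMon A (p + 1) q (by omega) x) +
        facesAbove D.left p n (evalMon A p (q + 1) (by omega) x) := by
  induction x using TensorProduct.induction_on with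
  | zero => simp
  | add x y hx hy =>
    simp only [map_add, hx, hy]
    abel
  | tmul f a =>
    have h1 : evalMon A p q h (differential (dupRelators K) D.op n (f ⊗ₜ[K] a)) =
        ∑ i : Fin n, ∑ e : DupGen, (-1 : K) ^ (i : ℕ) •
          f (insertGenerator (dupRelators K) e i (monOp K p q h)) • face (D.op e) rfl i a := by
      simp only [differential, LinearMap.sum_apply, map_sum]
      refine Finset.sum_congr rfl fun i _ => Finset.sum_congr rfl fun e _ => ?_
      rw [LinearMap.smul_apply, map_smul, TensorProduct.map_tmul, evalMon_tmul]
      rfl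
    rw [h1, facesBelow, facesAbove, LinearMap.sum_apply, LinearMap.sum_apply,
      ← Finset.sum_add_distrib]
    refine Finset.sum_congr rfl fun i _ => ?_
    rw [sum_dupGen, insertGenerator_left_monOp, insertGenerator_right_monOp, add_comm,
      evalMon_tmul, evalMon_tmul, map_smul, map_smul]
    congr 1
    · by_cases hi : (i : ℕ) ≤ p
      · rw [if_pos hi, if_pos (by omega), LinearMap.smul_apply, smul_comm]
        rfl
      · rw [if_neg hi, if_neg (by omega), map_zero, zero_smul, smul_zero, LinearMap.zero_apply,
          smul_zero]
    · by_cases hi : p ≤ (i : ℕ)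
      · rw [if_pos hi, if_pos hi, LinearMap.smul_apply, smul_comm]
        rfl
      · rw [if_neg hi, if_neg hi, map_zero, zero_smul, smul_zero, LinearMap.zero_apply, smul_zero]

variable (K A) in
/-- The operadic chains as families of tensors, by means of the basis of monomials. -/
def chainEquiv (n : ℕ) :
    Chains (dupRelators K) A (n + 1) ≃ₗ[K] (Fin (n + 1) → ⨂[K] _ : Fin (n + 1), A) :=
  TensorProduct.comm K _ _ ≪≫ₗ
    TensorProduct.congr (LinearEquiv.refl K _) (monBasis K n).dualBasis.equivFun ≪≫ₗ
    TensorProduct.piScalarRight K K _ (Fin (n + 1))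

theorem chainEquiv_apply (n : ℕ) (x : Chains (dupRelators K) A (n + 1)) (p : Fin (n + 1)) :
    chainEquiv K A n x p = evalMon A p (n - p) (by omega) x := by
  induction x using TensorProduct.induction_on with
  | zero => simp
  | add x y hx hy => simp only [map_add, Pi.add_apply, hx, hy]
  | tmul f a =>
    simp [chainEquiv, evalMon_tmul, monBasis_apply]

theorem totDiff_chainEquiv (D : DuplicialAlgebra K A) (n : ℕ)
    (x : Chains (dupRelators K) A (n + 2)) :
    totDiff D n (chainEquiv K A (n + 1) x) =
      chainEquiv K A n (differential (dupRelators K) D.op (n + 1) x) := by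
  have key : ∀ {p q p' q' : ℕ} (h : p + q + 1 = n + 2) (h' : p' + q' + 1 = n + 2), p = p' →
      evalMon A p q h x = evalMon A p' q' h' x := by
    rintro p q p' q' h h' rfl
    obtain rfl : q = q' := by omega
    rfl
  funext p
  rw [totDiff_apply, chainEquiv_apply, chainEquiv_apply, chainEquiv_apply, evalMon_differential]
  congr 2
  · exact key _ _ rfl
  · exact key _ _ rfl

theorem augmentation_eq {V : Type v} [AddCommGroup V] [Module K V] (π : A →ₗ[K] V)
    (x : Chains (dupRelators K) A 1) :
    augmentation (dupRelators K) π x =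
      π (PiTensorProduct.subsingletonEquiv (0 : Fin 1) (chainEquiv K A 0 x 0)) := by
  have h1 : monOp K 0 0 rfl = (koszulDual (dupRelators K)).one := by
    -- The only tree of arity one is the leaf, whose class is the identity.
    have : ∀ (t : PTree DupGen) (h : t.leaves = 1),
        treeClass (orthogonal (dupRelators K)) t h = (koszulDual (dupRelators K)).one := by
      intro t h
      obtain rfl := PTree.eq_of_leaves_eq_one h
      rfl
    exact this _ _
  rw [chainEquiv_apply]
  induction x using TensorProduct.induction_on with
  | zero => simp
  | add x y hx hy => simp only [map_add, hx, hy]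
  | tmul f a =>
    change _ = π (PiTensorProduct.subsingletonEquiv (0 : Fin 1) (evalMon A 0 0 _ (f ⊗ₜ[K] a)))
    rw [evalMon_tmul, h1]
    simp [augmentation]

/-- The operadic chain complex of a duplicial algebra with a contraction is acyclic. -/
theorem Contraction.isAcyclic {V : Type v} [AddCommGroup V] [Module K V]
    {D : DuplicialAlgebra K A} {ι : V →ₗ[K] A} {π : A →ₗ[K] V} (c : Contraction D ι π)
    (hπ : Function.Surjective π) : IsAcyclic (dupRelators K) D.op π where
  exact_of_pos n hn := by
    obtain ⟨n, rfl⟩ : ∃ m, n = m + 1 := ⟨n - 1, by omega⟩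
    intro x
    rw [← (chainEquiv K A n).map_eq_zero_iff, ← totDiff_chainEquiv, exact_totDiff c n]
    constructor
    · rintro ⟨y, hy⟩
      obtain ⟨y, rfl⟩ := (chainEquiv K A (n + 2)).surjective y
      rw [totDiff_chainEquiv] at hy
      exact ⟨y, (chainEquiv K A (n + 1)).injective hy⟩
    · rintro ⟨y, rfl⟩
      exact ⟨chainEquiv K A (n + 2) y, totDiff_chainEquiv D (n + 1) y⟩
  exact_one := by
    intro x
    rw [augmentation_eq]
    refine (exact_totDiff_zero c (chainEquiv K A 0 x)).trans ?_
    constructor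
    · rintro ⟨y, hy⟩
      obtain ⟨y, rfl⟩ := (chainEquiv K A 1).surjective y
      rw [totDiff_chainEquiv] at hy
      exact ⟨y, (chainEquiv K A 0).injective hy⟩
    · rintro ⟨y, rfl⟩
      exact ⟨chainEquiv K A 1 y, totDiff_chainEquiv D 0 y⟩
  surjective v := by
    obtain ⟨a, rfl⟩ := hπ v
    refine ⟨(chainEquiv K A 0).symm fun _ =>
      (PiTensorProduct.subsingletonEquiv (0 : Fin 1)).symm a, ?_⟩
    rw [augmentation_eq, LinearEquiv.apply_symm_apply, LinearEquiv.apply_symm_apply]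

/-! ### The bicomplex -/

/-- The isomorphism of tensor powers induced by an equality of exponents. -/
abbrev tcast {m n : ℕ} (h : m = n) : (⨂[K] _ : Fin m, A) ≃ₗ[K] ⨂[K] _ : Fin n, A :=
  PiTensorProduct.reindex K (fun _ : Fin m => A) (finCongr h)

theorem tcast_rfl {n : ℕ} (h : n = n) (x : ⨂[K] _ : Fin n, A) : tcast h x = x := by
  have : finCongr h = Equiv.refl _ := rfl
  rw [tcast, this, PiTensorProduct.reindex_refl]
  rfl

theorem tcast_tcast {l m n : ℕ} (h : l = m) (h' : m = n) (x : ⨂[K] _ : Fin l, A) :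
    tcast h' (tcast h x) = tcast (h.trans h') x := by
  subst h h'
  rw [tcast_rfl]

theorem face_eq_face_tcast (μ : A →ₗ[K] A →ₗ[K] A) {m k : ℕ} (h : m = k + 1) (i : Fin k)
    (x : ⨂[K] _ : Fin m, A) : face μ h i x = face μ rfl i (tcast h x) := by
  subst h
  rw [tcast_rfl]

theorem facesBelow_tcast (μ : A →ₗ[K] A →ₗ[K] A) (p : ℕ) {k l : ℕ} (h : k = l)
    (h' : k + 1 = l + 1) (x : ⨂[K] _ : Fin (k + 1), A) :
    facesBelow μ p l (tcast h' x) = tcast h (facesBelow μ p k x) := by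
  subst h
  rw [tcast_rfl, tcast_rfl]

theorem facesAbove_tcast (μ : A →ₗ[K] A →ₗ[K] A) (p : ℕ) {k l : ℕ} (h : k = l)
    (h' : k + 1 = l + 1) (x : ⨂[K] _ : Fin (k + 1), A) :
    facesAbove μ p l (tcast h' x) = tcast h (facesAbove μ p k x) := by
  subst h
  rw [tcast_rfl, tcast_rfl]

/-- The sum over `i ≤ p` is extended by zero to all the faces. The tensor exponent then depends only
on the total degree, and the bicomplex relations reduce to those of `facesBelow` and `facesAbove`.
-/
theorem dHor_apply (D : DuplicialAlgebra K A) (p q : ℕ) (x : Bi K A (p + 1) q) :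
    dHor D p q x = facesBelow D.right (p + 1) (p + q + 1)
      (tcast (by omega : p + 1 + q + 1 = p + q + 1 + 1) x) := by
  simp only [dHor, facesBelow, LinearMap.sum_apply]
  refine Finset.sum_of_injOn (fun i : Fin (p + 1) => (⟨i, by omega⟩ : Fin (p + q + 1))) ?_ ?_ ?_ ?_
  · intro i _ j _ hij
    simpa [Fin.ext_iff] using hij
  · intro i _
    simp
  · intro i _ hi
    rw [if_neg, LinearMap.zero_apply]
    intro h
    exact hi ⟨⟨i, h⟩, by simp, rfl⟩
  · intro i _
    rw [if_pos i.2, LinearMap.smul_apply, LinearMap.smul_apply, face_eq_face_tcast]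

theorem dVer_apply (D : DuplicialAlgebra K A) (p q : ℕ) (x : Bi K A p (q + 1)) :
    dVer D p q x = facesAbove D.left p (p + q + 1)
      (tcast (by omega : p + (q + 1) + 1 = p + q + 1 + 1) x) := by
  simp only [dVer, facesAbove, LinearMap.sum_apply]
  refine Finset.sum_of_injOn (fun i : Fin (q + 1) => (⟨p + i, by omega⟩ : Fin (p + q + 1)))
    ?_ ?_ ?_ ?_
  · intro i _ j _ hij
    simpa [Fin.ext_iff] using hij
  · intro i _
    simp
  · intro i _ hi
    rw [if_neg, LinearMap.zero_apply]
    intro h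
    exact hi ⟨⟨i - p, by omega⟩, by simp, Fin.ext (by simp; omega)⟩
  · intro i _
    rw [if_pos (by simp), LinearMap.smul_apply, LinearMap.smul_apply, face_eq_face_tcast]

theorem dHor_dHor (D : DuplicialAlgebra K A) (p q : ℕ) :
    dHor D p q ∘ₗ dHor D (p + 1) q = 0 := by
  refine LinearMap.ext fun x => ?_
  rw [LinearMap.comp_apply, dHor_apply, dHor_apply,
    ← facesBelow_tcast _ _ _ (by omega : p + 1 + q + 1 + 1 = p + q + 1 + 1 + 1)]
  exact LinearMap.congr_fun (facesBelow_facesBelow D.right_right (p + 1) (p + q + 1)) _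

theorem dVer_dVer (D : DuplicialAlgebra K A) (p q : ℕ) :
    dVer D p q ∘ₗ dVer D p (q + 1) = 0 := by
  refine LinearMap.ext fun x => ?_
  rw [LinearMap.comp_apply, dVer_apply, dVer_apply,
    ← facesAbove_tcast _ _ _ (by omega : p + (q + 1) + 1 + 1 = p + q + 1 + 1 + 1)]
  exact LinearMap.congr_fun (facesAbove_facesAbove D.left_left p (p + q + 1)) _

theorem dHor_dVer_add (D : DuplicialAlgebra K A) (p q : ℕ) :
    dHor D p q ∘ₗ dVer D (p + 1) q + dVer D p q ∘ₗ dHor D p (q + 1) = 0 := by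
  refine LinearMap.ext fun x => ?_
  rw [LinearMap.add_apply, LinearMap.comp_apply, LinearMap.comp_apply, dHor_apply, dHor_apply,
    dVer_apply, dVer_apply,
    ← facesBelow_tcast _ _ _ (by omega : p + (q + 1) + 1 + 1 = p + q + 1 + 1 + 1),
    ← facesAbove_tcast _ _ _ (by omega : p + 1 + q + 1 + 1 = p + q + 1 + 1 + 1),
    tcast_tcast, tcast_tcast]
  exact LinearMap.congr_fun (facesBelow_facesAbove D p (p + q + 1)) _

theorem toTot_apply (n : ℕ) (x : Chains (dupRelators K) A (n + 1))
    (s : {s : ℕ × ℕ // s.1 + s.2 = n}) :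
    toTot n x s = tcast (by rw [s.2])
      (evalMon A s.1.1 s.1.2 (by rw [s.2]) x) := by
  induction x using TensorProduct.induction_on with
  | zero => simp
  | add x y hx hy => simp only [map_add, Pi.add_apply, hx, hy]
  | tmul f a =>
    rw [evalMon_tmul, map_smul]
    simp [toTot]
    rfl

/-- The bidegree `(p, n - p)`. -/
def bidegree (n : ℕ) (p : Fin (n + 1)) : {s : ℕ × ℕ // s.1 + s.2 = n} :=
  ⟨(p, n - p), Nat.add_sub_cancel' (Nat.le_of_lt_succ p.2)⟩

/-- Up to the indexing `p ↦ (p, n - p)` and casts of tensor powers, this is the coordinate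
isomorphism `chainEquiv` given by the basis of monomials. -/
theorem toTot_bijective (n : ℕ) : Function.Bijective (toTot (K := K) (A := A) n) := by
  constructor
  · intro x y h
    refine (chainEquiv K A n).injective (funext fun p => ?_)
    have := congrFun h (bidegree n p)
    rw [toTot_apply, toTot_apply] at this
    rw [chainEquiv_apply, chainEquiv_apply]
    exact (tcast _).injective this
  · intro z
    refine ⟨(chainEquiv K A n).symm fun p =>
      (tcast (congrArg (· + 1) (bidegree n p).2.symm)).symm (z (bidegree n p)), ?_⟩
    funext s
    obtain ⟨⟨p, q⟩, h⟩ := s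
    obtain rfl : q = n - p := by simp only at h; omega
    rw [toTot_apply]
    have := chainEquiv_apply n ((chainEquiv K A n).symm fun p =>
      (tcast (congrArg (· + 1) (bidegree n p).2.symm)).symm (z (bidegree n p))) ⟨p, by omega⟩
    simp only [LinearEquiv.apply_symm_apply] at this
    rw [← this]
    exact LinearEquiv.apply_symm_apply _ _

theorem dTot_toTot (D : DuplicialAlgebra K A) (n : ℕ) :
    dTot D n ∘ₗ toTot (n + 1) =
      toTot n ∘ₗ differential (dupRelators K) D.op (n + 1) := by
  refine LinearMap.ext fun x => funext fun s => ?_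
  obtain ⟨⟨p, q⟩, h⟩ := s
  simp only at h
  subst h
  rw [LinearMap.comp_apply, LinearMap.comp_apply, toTot_apply, tcast_rfl, evalMon_differential]
  change dHor D p q (toTot (p + q + 1) x ⟨(p + 1, q), by simp only; omega⟩) +
    dVer D p q (toTot (p + q + 1) x ⟨(p, q + 1), rfl⟩) = _
  rw [dHor_apply, dVer_apply, toTot_apply, toTot_apply, tcast_tcast, tcast_tcast, tcast_rfl,
    tcast_rfl]

end Comparison

/-! ### The operad of duplicial algebras is a Koszul operad -/

section DupKoszul

variable (K : Type u) [Field K]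

/-- The duplicial algebra formed by the operations of `Dup` is free on one generator. -/
theorem isFreeDuplicial_totalDuplicial :
    IsFreeDuplicial (totalDuplicial K (le_refl (dupRelators K)))
      (DirectSum.lof K ℕ (fun n => (quadraticOperad (dupRelators K)).Op n) 1) := by
  intro B _ _ D' f
  have hB : IsAlgebraOfType (dupRelators K) D'.op := isAlgebraOfType_dupRelators_iff.2 ⟨D', rfl⟩
  -- The morphism `g` evaluates every operation with all its inputs equal to `b`, the image of the
  -- generator `id`.
  set b := f (quadraticOperad (dupRelators K)).one with hb
  let g : TotalSpace (dupRelators K) →ₗ[K] B :=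
    DirectSum.toModule K ℕ B fun n => evalOp hB (fun _ => b) n
  have hg : ∀ t, g (totalClass _ t) = t.eval (fun e x y => D'.op e x y) fun _ => b := fun t =>
    (DirectSum.toModule_lof K _ _).trans (evalOp_treeClass hB _ t rfl)
  have hgm : ∀ e x y, g (totalProduct (dupRelators K) e x y) = D'.op e (g x) (g y) := by
    intro e x y
    suffices h : (totalProduct (dupRelators K) e).compr₂ g = (D'.op e).compl₁₂ g g from
      LinearMap.congr_fun₂ h x y
    refine totalSpace_hom_ext fun t => totalSpace_hom_ext fun s => ?_
    rw [LinearMap.compr₂_apply, totalProduct_totalClass, LinearMap.compl₁₂_apply, hg, hg, hg]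
    rfl
  have hop : ∀ (t : PTree DupGen) (h : t.leaves = 1),
      treeClass (dupRelators K) t h = (quadraticOperad (dupRelators K)).one := by
    intro t h
    obtain rfl := PTree.eq_of_leaves_eq_one h
    rfl
  refine ⟨g, ⟨⟨hgm .left, hgm .right⟩, ?_⟩, ?_⟩
  · refine op_hom_ext fun t ht => ?_
    rw [LinearMap.comp_apply, lof_treeClass, hg, hop t ht, ← hb]
    obtain rfl := PTree.eq_of_leaves_eq_one ht
    rfl
  -- Uniqueness: the classes of trees are obtained from the leaf by the two products.
  · rintro g' ⟨⟨hl, hr⟩, hι⟩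
    refine totalSpace_hom_ext fun t => ?_
    rw [hg]
    induction t with
    | leaf => exact LinearMap.congr_fun hι (quadraticOperad (dupRelators K)).one
    | node e t s iht ihs =>
      have ht : t.eval (fun e x y => D'.op e x y) (fun _ => b) = g' (totalClass _ t) := iht.symm
      have hs : s.eval (fun e x y => D'.op e x y) (fun _ => b) = g' (totalClass _ s) := ihs.symm
      rw [PTree.eval, ht, hs, ← totalProduct_totalClass]
      cases e
      · exact hl _ _
      · exact hr _ _

theorem component_one_totalProduct {E : Type} (R : Submodule K (TreeModule K E 3)) (e : E)
    (x y : TotalSpace R) :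
    DirectSum.component K ℕ (fun n => (quadraticOperad R).Op n) 1 (totalProduct R e x y) = 0 := by
  suffices h : (totalProduct R e).compr₂
      (DirectSum.component K ℕ (fun n => (quadraticOperad R).Op n) 1) = 0 from
    LinearMap.congr_fun₂ h x y
  refine totalSpace_hom_ext fun t => totalSpace_hom_ext fun s => ?_
  rw [LinearMap.compr₂_apply, totalProduct_totalClass, totalClass, DirectSum.component.of, dif_neg]
  · rfl
  · have := t.leaves_pos
    have := s.leaves_pos
    simp only [PTree.leaves]
    omega

/-- The Koszul complex is the operadic chain complex of the free duplicial algebra on `Dup_1`, with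
the projection onto arity one as augmentation. That projection kills products, since these have
arity at least two, so the contraction of free algebras applies. -/
theorem isKoszul_dupRelators : IsKoszul (dupRelators K) := by
  have hι : DirectSum.component K ℕ (fun n => (quadraticOperad (dupRelators K)).Op n) 1 ∘ₗ
      DirectSum.lof K ℕ (fun n => (quadraticOperad (dupRelators K)).Op n) 1 = LinearMap.id :=
    LinearMap.ext fun x => DirectSum.component.lof_self K 1 x
  have hc : Nonempty (Contraction (totalDuplicial K (le_refl (dupRelators K)))
      (DirectSum.lof K ℕ (fun n => (quadraticOperad (dupRelators K)).Op n) 1)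
      (DirectSum.component K ℕ (fun n => (quadraticOperad (dupRelators K)).Op n) 1)) :=
    IsFreeDuplicial.nonempty_contraction.{u, u} (isFreeDuplicial_totalDuplicial K) hι
      (component_one_totalProduct K (dupRelators K) .right)
      (component_one_totalProduct K (dupRelators K) .left)
  obtain ⟨c⟩ := hc
  have h := c.isAcyclic fun x => ⟨DirectSum.lof K ℕ (fun n => (quadraticOperad (dupRelators K)).Op n) 1 x,
    LinearMap.congr_fun hι x⟩
  rw [totalDuplicial_op] at h
  exact h

end DupKoszul

end NSKoszul

end

theorem theorem5p4 (K : Type u) [Field K] :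
    -- the operad of duplicial algebras is a Koszul operad
    NSKoszul.IsKoszul (NSKoszul.dupRelators K) ∧
    -- its Koszul dual is presented by the duplicial relators and the two additional ones
    NSKoszul.orthogonal (NSKoszul.dupRelators K) =
      NSKoszul.dupRelators K ⊔ NSKoszul.dupExtraRelators K ∧
    -- that is, algebras over the dual are duplicial algebras with `(x ≺ y) ≻ z = 0 = x ≺ (y ≻ z)`
    (∀ (A : Type w) [AddCommGroup A] [Module K A] (op : NSKoszul.DupGen → A →ₗ[K] A →ₗ[K] A),
      NSKoszul.IsAlgebraOfType (NSKoszul.orthogonal (NSKoszul.dupRelators K)) op ↔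
        ∃ D : NSKoszul.DuplicialAlgebra K A, D.op = op ∧
          (∀ x y z : A, D.right (D.left x y) z = 0) ∧
          (∀ x y z : A, D.left x (D.right y z) = 0)) ∧
    -- the operadic chain complex of a duplicial algebra is the total complex of a bicomplex
    (∀ (A : Type w) [AddCommGroup A] [Module K A] (D : NSKoszul.DuplicialAlgebra K A),
      (∀ p q : ℕ, NSKoszul.dHor D p q ∘ₗ NSKoszul.dHor D (p + 1) q = 0) ∧
      (∀ p q : ℕ, NSKoszul.dVer D p q ∘ₗ NSKoszul.dVer D p (q + 1) = 0) ∧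
      (∀ p q : ℕ, NSKoszul.dHor D p q ∘ₗ NSKoszul.dVer D (p + 1) q +
        NSKoszul.dVer D p q ∘ₗ NSKoszul.dHor D p (q + 1) = 0) ∧
      (∀ n : ℕ, Function.Bijective (NSKoszul.toTot (K := K) (A := A) n)) ∧
      (∀ n : ℕ, NSKoszul.dTot D n ∘ₗ NSKoszul.toTot (n + 1) =
        NSKoszul.toTot n ∘ₗ
          NSKoszul.differential (NSKoszul.dupRelators K) D.op (n + 1))) ∧
    -- the operadic chain complex of a free duplicial algebra on `V` is acyclic: its homology is `V`
    -- in degree `1` and zero in degrees at least `2`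
    (∀ (V : Type v) [AddCommGroup V] [Module K V] (A : Type (max u v)) [AddCommGroup A]
      [Module K A] (D : NSKoszul.DuplicialAlgebra K A) (ι : V →ₗ[K] A),
      NSKoszul.IsFreeDuplicial D ι →
        ∃ π : A →ₗ[K] V, π ∘ₗ ι = LinearMap.id ∧
          NSKoszul.IsAcyclic (NSKoszul.dupRelators K) D.op π) := by
  refine ⟨NSKoszul.isKoszul_dupRelators K, NSKoszul.orthogonal_dupRelators,
    fun A _ _ op => NSKoszul.isAlgebraOfType_orthogonal_dupRelators_iff,
    fun A _ _ D => ⟨NSKoszul.dHor_dHor D, NSKoszul.dVer_dVer D, NSKoszul.dHor_dVer_add D,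
      NSKoszul.toTot_bijective, NSKoszul.dTot_toTot D⟩, fun V _ _ A _ _ D ι hD => ?_⟩
  obtain ⟨π, hπ, hr, hl⟩ := hD.exists_proj
  obtain ⟨c⟩ := hD.nonempty_contraction hπ hr hl
  exact ⟨π, hπ, c.isAcyclic fun v => ⟨ι v, LinearMap.congr_fun hπ v⟩⟩
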